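/- **Setting.** Let $m\in\mathbb N$. For $k\in\mathbb Z$ let $A(k),B(k)\in\mathbb C^{2m\times 2m}$ and $\rho(k)\in\mathbb C^{m\times m}$ with $A(k)\ge 0$, $B(k)=B(k)^*$, $\rho(k)>0$, and suppose that the upper right $m\times m$ block $zA_{1,2}(k)+B_{1,2}(k)$ is invertible for all $z\in\mathbb C$, $k\in\mathbb Z$. For $y=(y_1,y_2)^\top$ put $(\mathcal S_\rho y)(k)=(\rho(k)y_2(k+1),\,\rho(k-1)y_1(k-1))^\top$ and $\hat y(k)=(y_1(k),y_2(k+1))^\top$. Assume that for every $z\in\mathbb C$, every nontrivial solution $\psi$ of $$\mathcal S_\rho\psi=(zA+B)\psi \qquad (\mathrm H)$$ on $\mathbb Z$ and all integers $c<d$ one has $\sum_{k=c}^d\psi(k)^*A(k)\psi(k)>0$. For $I\subseteq\mathbb Z$ let $\ell^2_A(I)$ be the set of $\phi$ with $\sum_{k\in I}\phi(k)^*A(k)\phi(k)<\infty$. Put $$J=\begin{pmatrix}0&I_m\\-I_m&0\end{pmatrix},\quad J_\rho(k)=\begin{pmatrix}0&\rho(k)\\-\rho(k)&0\end{pmatrix},\quad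 I_\rho(k)=\begin{pmatrix}\rho(k)&0\\0&\rho(k)\end{pmatrix}.$$ Fix $k_0\in\mathbb Z$ and $\alpha\in\mathbb C^{m\times 2m}$ with $\alpha\alpha^*=I_m$, $\alpha J\alpha^*=0$; put $\tilde\alpha=\alpha I_\rho(k_0)^{1/2}$ and let $\Psi(z,\cdot)$ be the $2m\times 2m$ matrix solution of (H) with $\hat\Psi(z,k_0)=I_\rho(k_0)^{-1}(\tilde\alpha^*\ \ J\tilde\alpha^*)$. For $M\in\mathbb C^{m\times m}$ let $U(z,k)=\Psi(z,k)\begin{pmatrix}I_m\\M\end{pmatrix}$ and, for $\ell\ne k_0$ and $z\in\mathbb C\setminus\mathbb R$, $$E_\ell(M)=\sigma\,\hat U(z,\ell)^*(-iJ_\rho(\ell))\hat U(z,\ell),\qquad \sigma=\frac{(\ell-k_0)\operatorname{Im}z}{|(\ell-k_0)\operatorname{Im}z|}.$$ Let $\mathcal D_+(z)$ (resp. $\mathcal D_-(z)$) be the set of all $M$ with $E_\ell(M)\le0$ for all $\ell>k_0$ (resp. all $\ell<k_0$). The system is in the *limit point case* at $\pm\infty$ if $\mathcal D_\pm(z)$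 is a singleton, and in the *limit circle case* at $\pm\infty$ if $\mathcal D_\pm(z)$ has nonempty interior. Let $N(z,\infty)$ (resp. $N(z,-\infty)$) be the space of solutions of (H) on $\mathbb Z$ that are in $\ell^2_A([k_0,\infty))$ (resp. $\ell^2_A((-\infty,k_0])$). Let $z\in\mathbb C\setminus\mathbb R$ and $M_\pm(z)\in\partial\mathcal D_\pm(z)$, put $M_\pm(\bar z)=M_\pm(z)^*$ and $\omega=(M_-(z)-M_+(z))^{-1}$, and let $U_\pm(z,\cdot)$, $U_\pm(\bar z,\cdot)$, with $m\times m$ blocks $u_{\pm,1},u_{\pm,2}$, be built from $M_\pm(z)$, $M_\pm(\bar z)$; write $F^{\circledast}(z,k)=F(\bar z,k)^*$. The Green's matrix is $$K(z,k,\ell)=\begin{cases}U_+(z,k)\,\omega\, U_-(\bar z,\ell)^*,&k>\ell,\\[2pt] \begin{pmatrix}u_{+,1}(z,k)\omega u_{-,1}(\bar z,k)^*&u_{+,1}(z,k)\omega u_{-,2}(\bar z,k)^*\\u_{-,2}(z,k)\omega u_{+,1}(\bar z,k)^*&u_{-,2}(z,k)\omega u_{+,2}(\bar z,k)^*\end{pmatrix},&k=\ell,\\[2pt]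 U_-(z,k)\,\omega\, U_+(\bar z,\ell)^*,&k<\ell.\end{cases}$$ **Theorem.** Suppose that at each of $\infty$ and $-\infty$ the system is in the limit point or in the limit circle case. Let $f\in\ell^2_A(\mathbb Z)$ and let $$y(z,k)=\sum_{\ell\in\mathbb Z}K(z,k,\ell)A(\ell)f(\ell).$$ Then the series converges for every $k$, and $y(z,\cdot)$ is the unique $\ell^2_A(\mathbb Z)$-solution on $\mathbb Z$ of $$\mathcal S_\rho\psi=(zA+B)\psi+Af\qquad(\mathrm N)$$ that satisfies the boundary conditions $$\lim_{k\to\infty}\hat U_+^{\circledast}(z,k)J_\rho(k)\hat y(z,k)=0,\qquad \lim_{k\to-\infty}\hat U_-^{\circledast}(z,k)J_\rho(k)\hat y(z,k)=0 .$$ Moreover, if the system is in the limit point case at $\infty$ (resp. $-\infty$) with $\dim N(z,\infty)=m$ (resp. $\dim N(z,-\infty)=m$), then the corresponding boundary condition is satisfied by every $\ell^2_A(\mathbb Z)$-solution of (N) and can be dropped: $y(z,\cdot)$ is the unique $\ell^2_A(\mathbb Z)$-solution of (N) that satisfies the other boundary condition; and if this holds at both endpoints, $y(z,\cdot)$ is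 the unique $\ell^2_A(\mathbb Z)$-solution of (N). -/

import Mathlib

open Matrix Filter Topology

open scoped ComplexOrder

noncomputable section

/-- The coefficients `A`, `B`, `ρ` of a discrete Hamiltonian system on `ℤ`.  The index type
`Fin m ⊕ Fin m` stands for the `2m` coordinates; `Sum.inl` and `Sum.inr` are the two blocks. -/
structure HamSystem (m : ℕ) where
  A : ℤ → Matrix (Fin m ⊕ Fin m) (Fin m ⊕ Fin m) ℂ
  B : ℤ → Matrix (Fin m ⊕ Fin m) (Fin m ⊕ Fin m) ℂ
  ρ : ℤ → Matrix (Fin m) (Fin m) ℂ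

namespace HamSystem

variable {m : ℕ}

/-- The matrix `z A(k) + B(k)`. -/
def coeff (S : HamSystem m) (z : ℂ) (k : ℤ) : Matrix (Fin m ⊕ Fin m) (Fin m ⊕ Fin m) ℂ :=
  z • S.A k + S.B k

/-- The difference expression `𝒮_ρ`: `(𝒮_ρ y)(k) = (ρ(k) y₂(k+1), ρ(k-1) y₁(k-1))`. -/
def shiftExpr (S : HamSystem m) (y : ℤ → Fin m ⊕ Fin m → ℂ) (k : ℤ) : Fin m ⊕ Fin m → ℂ :=
  Sum.elim (S.ρ k *ᵥ fun i => y (k + 1) (Sum.inr i))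
    (S.ρ (k - 1) *ᵥ fun i => y (k - 1) (Sum.inl i))

/-- `y` solves the homogeneous system `𝒮_ρ y = (zA + B) y` on `ℤ`. -/
def IsSol (S : HamSystem m) (z : ℂ) (y : ℤ → Fin m ⊕ Fin m → ℂ) : Prop :=
  ∀ k, S.shiftExpr y k = S.coeff z k *ᵥ y k

/-- `y` solves the nonhomogeneous system `𝒮_ρ y = (zA + B) y + A f` on `ℤ`. -/
def IsSolNonhom (S : HamSystem m) (z : ℂ) (f y : ℤ → Fin m ⊕ Fin m → ℂ) : Prop :=
  ∀ k, S.shiftExpr y k = S.coeff z k *ᵥ y k + S.A k *ᵥ f k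

/-- The (real) number `φ(k)^* A(k) φ(k)`. -/
def energy (S : HamSystem m) (φ : ℤ → Fin m ⊕ Fin m → ℂ) (k : ℤ) : ℝ :=
  (star (φ k) ⬝ᵥ (S.A k *ᵥ φ k)).re

/-- The standing hypotheses on the coefficients: `A ≥ 0`, `B = B^*`, `ρ > 0`, invertibility of
`z A₁₂ + B₁₂`, and definiteness on discrete intervals with at least two points. -/
structure Hyp (S : HamSystem m) : Prop where
  A_nonneg : ∀ k, (S.A k).PosSemidef
  B_selfAdjoint : ∀ k, (S.B k).IsHermitian
  ρ_pos : ∀ k, (S.ρ k).PosDef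
  isUnit_coeff₁₂ : ∀ z k, IsUnit (S.coeff z k).toBlocks₁₂
  definite : ∀ (z : ℂ) (y : ℤ → Fin m ⊕ Fin m → ℂ), S.IsSol z y → y ≠ 0 →
    ∀ c d : ℤ, c < d → 0 < ∑ k ∈ Finset.Icc c d, S.energy y k

/-- Membership in `ℓ²_A(I)`; for `A ≥ 0` the summands are nonnegative. -/
def MemL2 (S : HamSystem m) (I : Set ℤ) (φ : ℤ → Fin m ⊕ Fin m → ℂ) : Prop :=
  Summable fun k : I => S.energy φ k

/-- The matrix `J = [[0, 1], [-1, 0]]`. -/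
def J (m : ℕ) : Matrix (Fin m ⊕ Fin m) (Fin m ⊕ Fin m) ℂ :=
  fromBlocks 0 1 (-1) 0

/-- The matrix `J_ρ(k) = [[0, ρ(k)], [-ρ(k), 0]]`. -/
def Jρ (S : HamSystem m) (k : ℤ) : Matrix (Fin m ⊕ Fin m) (Fin m ⊕ Fin m) ℂ :=
  fromBlocks 0 (S.ρ k) (-S.ρ k) 0

/-- The matrix `I_ρ(k) = diag(ρ(k), ρ(k))`. -/
def Iρ (S : HamSystem m) (k : ℤ) : Matrix (Fin m ⊕ Fin m) (Fin m ⊕ Fin m) ℂ :=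
  fromBlocks (S.ρ k) 0 0 (S.ρ k)

/-- `ŷ(k) = (y₁(k), y₂(k+1))` for a sequence of vectors. -/
def hat (y : ℤ → Fin m ⊕ Fin m → ℂ) (k : ℤ) : Fin m ⊕ Fin m → ℂ :=
  Sum.elim (fun i => y k (Sum.inl i)) (fun i => y (k + 1) (Sum.inr i))

/-- `F̂(k) = (F₁(k), F₂(k+1))` for a sequence of matrices with `2m` rows. -/
def hatMat {n : Type*} (F : ℤ → Matrix (Fin m ⊕ Fin m) n ℂ) (k : ℤ) :
    Matrix (Fin m ⊕ Fin m) n ℂ :=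
  fromRows (F k).toRows₁ (F (k + 1)).toRows₂

/-- Boundary data: `α α^* = 1` and `α J α^* = 0`. -/
def IsBoundaryData (α : Matrix (Fin m) (Fin m ⊕ Fin m) ℂ) : Prop :=
  α * αᴴ = 1 ∧ α * J m * αᴴ = 0

open scoped MatrixOrder in
/-- `α̃(k) = α I_ρ(k)^{1/2}`, with the positive definite square root. -/
def tilde (S : HamSystem m) (α : Matrix (Fin m) (Fin m ⊕ Fin m) ℂ) (k : ℤ) :
    Matrix (Fin m) (Fin m ⊕ Fin m) ℂ :=
  α * CFC.sqrt (S.Iρ k)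

/-! ### The solution of the initial value problem

The data at `k` are `(ψ₁(k), ψ₂(k+1))`; the system at `k` links the data at `k - 1` and `k`. -/

/-- From the data at `k - 1` to the data at `k`. -/
def fwdStep {n : Type*} (S : HamSystem m) (z : ℂ) (k : ℤ)
    (X : Matrix (Fin m) n ℂ × Matrix (Fin m) n ℂ) : Matrix (Fin m) n ℂ × Matrix (Fin m) n ℂ :=
  let P := (S.coeff z k).toBlocks₂₁⁻¹ * (S.ρ (k - 1) * X.1 - (S.coeff z k).toBlocks₂₂ * X.2)
  (P, (S.ρ k)⁻¹ * ((S.coeff z k).toBlocks₁₁ * P + (S.coeff z k).toBlocks₁₂ * X.2))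

/-- From the data at `k` to the data at `k - 1`. -/
def bwdStep {n : Type*} (S : HamSystem m) (z : ℂ) (k : ℤ)
    (X : Matrix (Fin m) n ℂ × Matrix (Fin m) n ℂ) : Matrix (Fin m) n ℂ × Matrix (Fin m) n ℂ :=
  let Q := (S.coeff z k).toBlocks₁₂⁻¹ * (S.ρ k * X.2 - (S.coeff z k).toBlocks₁₁ * X.1)
  ((S.ρ (k - 1))⁻¹ * ((S.coeff z k).toBlocks₂₁ * X.1 + (S.coeff z k).toBlocks₂₂ * Q), Q)

/-- The data at `k₀ + n`. -/
def fwd {n : Type*} (S : HamSystem m) (z : ℂ) (k₀ : ℤ)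
    (X : Matrix (Fin m) n ℂ × Matrix (Fin m) n ℂ) : ℕ → Matrix (Fin m) n ℂ × Matrix (Fin m) n ℂ
  | 0 => X
  | j + 1 => S.fwdStep z (k₀ + (j + 1)) (S.fwd z k₀ X j)

/-- The data at `k₀ - n`. -/
def bwd {n : Type*} (S : HamSystem m) (z : ℂ) (k₀ : ℤ)
    (X : Matrix (Fin m) n ℂ × Matrix (Fin m) n ℂ) : ℕ → Matrix (Fin m) n ℂ × Matrix (Fin m) n ℂ
  | 0 => X
  | j + 1 => S.bwdStep z (k₀ - j) (S.bwd z k₀ X j)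

/-- The data at `k` of the solution whose data at `k₀` are `X`. -/
def ivpData {n : Type*} (S : HamSystem m) (z : ℂ) (k₀ : ℤ)
    (X : Matrix (Fin m) n ℂ × Matrix (Fin m) n ℂ) (k : ℤ) :
    Matrix (Fin m) n ℂ × Matrix (Fin m) n ℂ :=
  if k₀ ≤ k then S.fwd z k₀ X (k - k₀).toNat else S.bwd z k₀ X (k₀ - k).toNat

/-- The matrix solution `Ψ` with `Ψ̂(k₀) = X`. -/
def ivp {n : Type*} (S : HamSystem m) (z : ℂ) (k₀ : ℤ) (X : Matrix (Fin m ⊕ Fin m) n ℂ) (k : ℤ) :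
    Matrix (Fin m ⊕ Fin m) n ℂ :=
  fromRows (S.ivpData z k₀ (X.toRows₁, X.toRows₂) k).1
    (S.ivpData z k₀ (X.toRows₁, X.toRows₂) (k - 1)).2

theorem coeff_conjTranspose {S : HamSystem m} (hS : S.Hyp) (z : ℂ) (k : ℤ) :
    (S.coeff (star z) k)ᴴ = S.coeff z k := by
  simp only [coeff, conjTranspose_add, conjTranspose_smul, star_star,
    (hS.A_nonneg k).isHermitian.eq, (hS.B_selfAdjoint k).eq]

theorem isUnit_coeff₂₁ {S : HamSystem m} (hS : S.Hyp) (z : ℂ) (k : ℤ) :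
    IsUnit (S.coeff z k).toBlocks₂₁ := by
  have h : (S.coeff z k).toBlocks₂₁ = ((S.coeff (star z) k).toBlocks₁₂)ᴴ := by
    rw [← coeff_conjTranspose hS z k]
    rfl
  rw [h]
  exact (hS.isUnit_coeff₁₂ (star z) k).star

/-- The two block equations of the system, for consecutive data. -/
def Linked {n : Type*} (S : HamSystem m) (z : ℂ) (k : ℤ)
    (X Y : Matrix (Fin m) n ℂ × Matrix (Fin m) n ℂ) : Prop :=
  S.ρ k * Y.2 = (S.coeff z k).toBlocks₁₁ * Y.1 + (S.coeff z k).toBlocks₁₂ * X.2 ∧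
  S.ρ (k - 1) * X.1 = (S.coeff z k).toBlocks₂₁ * Y.1 + (S.coeff z k).toBlocks₂₂ * X.2

theorem mul_inv_mul {n : Type*} {M : Matrix (Fin m) (Fin m) ℂ} (h : IsUnit M)
    (N : Matrix (Fin m) n ℂ) : M * (M⁻¹ * N) = N := by
  rw [← Matrix.mul_assoc, Matrix.mul_nonsing_inv _ ((Matrix.isUnit_iff_isUnit_det _).1 h),
    Matrix.one_mul]

theorem linked_fwdStep {n : Type*} {S : HamSystem m} (hS : S.Hyp) (z : ℂ) (k : ℤ)
    (X : Matrix (Fin m) n ℂ × Matrix (Fin m) n ℂ) : S.Linked z k X (S.fwdStep z k X) := by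
  constructor
  · simp only [fwdStep, mul_inv_mul (hS.ρ_pos k).isUnit]
  · simp only [fwdStep, mul_inv_mul (isUnit_coeff₂₁ hS z k), sub_add_cancel]

theorem linked_bwdStep {n : Type*} {S : HamSystem m} (hS : S.Hyp) (z : ℂ) (k : ℤ)
    (X : Matrix (Fin m) n ℂ × Matrix (Fin m) n ℂ) : S.Linked z k (S.bwdStep z k X) X := by
  constructor
  · simp only [bwdStep, mul_inv_mul (hS.isUnit_coeff₁₂ z k), add_sub_cancel]
  · simp only [bwdStep, mul_inv_mul (hS.ρ_pos (k - 1)).isUnit]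

theorem linked_ivpData {n : Type*} {S : HamSystem m} (hS : S.Hyp) (z : ℂ) (k₀ : ℤ)
    (X : Matrix (Fin m) n ℂ × Matrix (Fin m) n ℂ) (k : ℤ) :
    S.Linked z k (S.ivpData z k₀ X (k - 1)) (S.ivpData z k₀ X k) := by
  rcases lt_trichotomy k₀ k with h | h | h
  · obtain ⟨j, rfl⟩ : ∃ j : ℕ, k = k₀ + (j + 1) := ⟨(k - k₀ - 1).toNat, by omega⟩
    have e1 : (k₀ + ((j : ℤ) + 1) - k₀).toNat = j + 1 := by omega
    have e2 : (k₀ + ((j : ℤ) + 1) - 1 - k₀).toNat = j := by omega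
    rw [ivpData, ivpData, if_pos (by omega), if_pos (by omega), e1, e2]
    exact linked_fwdStep hS z _ _
  · subst h
    have e1 : (k₀ - (k₀ - 1)).toNat = 0 + 1 := by omega
    rw [ivpData, ivpData, if_neg (by omega), if_pos le_rfl, e1, sub_self]
    have := linked_bwdStep hS z k₀ X
    simpa [bwd, fwd] using this
  · obtain ⟨j, rfl⟩ : ∃ j : ℕ, k = k₀ - j := ⟨(k₀ - k).toNat, by omega⟩
    have e1 : (k₀ - (k₀ - (j : ℤ))).toNat = j := by omega
    have e2 : (k₀ - (k₀ - (j : ℤ) - 1)).toNat = j + 1 := by omega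
    rw [ivpData, ivpData, if_neg (by omega), if_neg (by omega), e1, e2]
    exact linked_bwdStep hS z _ _

/-- Every column of `ivp` solves the homogeneous system. -/
theorem isSol_ivp {n : Type*} {S : HamSystem m} (hS : S.Hyp) (z : ℂ) (k₀ : ℤ)
    (X : Matrix (Fin m ⊕ Fin m) n ℂ) (j : n) : S.IsSol z fun k i => S.ivp z k₀ X k i j := by
  intro k
  obtain ⟨h1, h2⟩ := linked_ivpData hS z k₀ (X.toRows₁, X.toRows₂) k
  ext i
  rcases i with i | i
  · have := congrFun (congrFun h1 i) j
    simpa [shiftExpr, ivp, mulVec, dotProduct, Matrix.mul_apply, toBlocks₁₁, toBlocks₁₂] using this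
  · have := congrFun (congrFun h2 i) j
    simpa [shiftExpr, ivp, mulVec, dotProduct, Matrix.mul_apply, toBlocks₂₁, toBlocks₂₂] using this

/-- `ivp` has the prescribed initial value. -/
theorem hatMat_ivp {n : Type*} (S : HamSystem m) (z : ℂ) (k₀ : ℤ)
    (X : Matrix (Fin m ⊕ Fin m) n ℂ) : hatMat (S.ivp z k₀ X) k₀ = X := by
  ext i j
  rcases i with i | i <;> simp [hatMat, ivp, ivpData, fwd]

/-! ### Weyl disks -/

/-- The normalized fundamental system `Ψ(z, ·, k₀, α̃) = (Θ  Φ)`, with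
`Ψ̂(z, k₀) = I_ρ(k₀)⁻¹ (α̃^*  J α̃^*)`. -/
def Ψ (S : HamSystem m) (k₀ : ℤ) (α : Matrix (Fin m) (Fin m ⊕ Fin m) ℂ) (z : ℂ) :
    ℤ → Matrix (Fin m ⊕ Fin m) (Fin m ⊕ Fin m) ℂ :=
  S.ivp z k₀ ((S.Iρ k₀)⁻¹ * fromCols (S.tilde α k₀)ᴴ (J m * (S.tilde α k₀)ᴴ))

/-- `U(z, k) = Ψ(z, k) (I; M) = Θ(z, k) + Φ(z, k) M`. -/
def U (S : HamSystem m) (k₀ : ℤ) (α : Matrix (Fin m) (Fin m ⊕ Fin m) ℂ)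
    (M : Matrix (Fin m) (Fin m) ℂ) (z : ℂ) (k : ℤ) : Matrix (Fin m ⊕ Fin m) (Fin m) ℂ :=
  S.Ψ k₀ α z k * fromRows 1 M

/-- `σ(ℓ, k, z) = (ℓ - k) Im z / |(ℓ - k) Im z|`. -/
def σ (ℓ k : ℤ) (z : ℂ) : ℝ :=
  (((ℓ - k : ℤ) : ℝ) * z.im) / |((ℓ - k : ℤ) : ℝ) * z.im|

/-- `E_ℓ(M) = σ(ℓ, k₀, z) Û(z, ℓ)^* (-i J_ρ(ℓ)) Û(z, ℓ)`.  With `J = [[0, 1], [-1, 0]]` this is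
the sign for which `2 σ Im M = -E_ℓ(M) + 2 |Im z| ∑ U^* A U`. -/
def E (S : HamSystem m) (k₀ : ℤ) (α : Matrix (Fin m) (Fin m ⊕ Fin m) ℂ) (z : ℂ) (ℓ : ℤ)
    (M : Matrix (Fin m) (Fin m) ℂ) : Matrix (Fin m) (Fin m) ℂ :=
  (σ ℓ k₀ z : ℂ) •
    ((hatMat (S.U k₀ α M z) ℓ)ᴴ * (-Complex.I • S.Jρ ℓ) * hatMat (S.U k₀ α M z) ℓ)

/-- The Weyl disk at `ℓ ≠ k₀`: all `M` with `E_ℓ(M) ≤ 0`. -/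
def weylDisk (S : HamSystem m) (k₀ : ℤ) (α : Matrix (Fin m) (Fin m ⊕ Fin m) ℂ) (z : ℂ) (ℓ : ℤ) :
    Set (Matrix (Fin m) (Fin m) ℂ) :=
  {M | (-S.E k₀ α z ℓ M).PosSemidef}

/-- The limiting disk at `+∞`. -/
def limDiskPlus (S : HamSystem m) (k₀ : ℤ) (α : Matrix (Fin m) (Fin m ⊕ Fin m) ℂ) (z : ℂ) :
    Set (Matrix (Fin m) (Fin m) ℂ) :=
  ⋂ ℓ ∈ Set.Ioi k₀, S.weylDisk k₀ α z ℓ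

/-- The limiting disk at `-∞`. -/
def limDiskMinus (S : HamSystem m) (k₀ : ℤ) (α : Matrix (Fin m) (Fin m ⊕ Fin m) ℂ) (z : ℂ) :
    Set (Matrix (Fin m) (Fin m) ℂ) :=
  ⋂ ℓ ∈ Set.Iio k₀, S.weylDisk k₀ α z ℓ

/-- Limit point case, in terms of the limiting disk `D`. -/
def IsLimitPoint (D : Set (Matrix (Fin m) (Fin m) ℂ)) : Prop := ∃ M, D = {M}

/-- Limit circle case, in terms of the limiting disk `D`. -/
def IsLimitCircle (D : Set (Matrix (Fin m) (Fin m) ℂ)) : Prop := (interior D).Nonempty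

/-- `N(z, I)`: the solutions of the homogeneous system that are in `ℓ²_A(I)`.  For a system
satisfying `Hyp` this is a linear space, of dimension at most `2m`. -/
def solSpace (S : HamSystem m) (z : ℂ) (I : Set ℤ) : Set (ℤ → Fin m ⊕ Fin m → ℂ) :=
  {φ | S.IsSol z φ ∧ S.MemL2 I φ}

/-! ### The Green's matrix -/

/-- The Green's matrix `K(z, k, ℓ)` for `M₊ = M₊(z)`, `M₋ = M₋(z)`, with `M±(z̄) = M±(z)^*` and
`ω = (M₋ - M₊)⁻¹`. -/
def green (S : HamSystem m) (k₀ : ℤ) (α : Matrix (Fin m) (Fin m ⊕ Fin m) ℂ)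
    (Mp Mm : Matrix (Fin m) (Fin m) ℂ) (z : ℂ) (k ℓ : ℤ) :
    Matrix (Fin m ⊕ Fin m) (Fin m ⊕ Fin m) ℂ :=
  let ω : Matrix (Fin m) (Fin m) ℂ := (Mm - Mp)⁻¹
  let Up := S.U k₀ α Mp z
  let Um := S.U k₀ α Mm z
  let Up' := S.U k₀ α Mpᴴ (star z)
  let Um' := S.U k₀ α Mmᴴ (star z)
  if ℓ < k then Up k * ω * (Um' ℓ)ᴴ
  else if k < ℓ then Um k * ω * (Up' ℓ)ᴴ
  else fromBlocks
    ((Up k).toRows₁ * ω * (Um' k).toRows₁ᴴ) ((Up k).toRows₁ * ω * (Um' k).toRows₂ᴴ)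
    ((Um k).toRows₂ * ω * (Up' k).toRows₁ᴴ) ((Um k).toRows₂ * ω * (Up' k).toRows₂ᴴ)

/-- `y(z, k) = ∑_ℓ K(z, k, ℓ) A(ℓ) f(ℓ)`. -/
def greenSol (S : HamSystem m) (k₀ : ℤ) (α : Matrix (Fin m) (Fin m ⊕ Fin m) ℂ)
    (Mp Mm : Matrix (Fin m) (Fin m) ℂ) (z : ℂ) (f : ℤ → Fin m ⊕ Fin m → ℂ) (k : ℤ) :
    Fin m ⊕ Fin m → ℂ :=
  ∑' ℓ : ℤ, S.green k₀ α Mp Mm z k ℓ *ᵥ (S.A ℓ *ᵥ f ℓ)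

/-- The boundary condition `lim Û^⊛(z, k) J_ρ(k) ŷ(k) = 0` along `F` (`atTop` or `atBot`), where
`U` is built from `M` and `U^⊛(z, k) = U(z̄, k)^*` with `M(z̄) = M(z)^*`. -/
def BC (S : HamSystem m) (k₀ : ℤ) (α : Matrix (Fin m) (Fin m ⊕ Fin m) ℂ)
    (M : Matrix (Fin m) (Fin m) ℂ) (z : ℂ) (F : Filter ℤ) (y : ℤ → Fin m ⊕ Fin m → ℂ) : Prop :=
  Tendsto (fun k => (hatMat (S.U k₀ α Mᴴ (star z)) k)ᴴ *ᵥ (S.Jρ k *ᵥ hat y k)) F (𝓝 0)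

end HamSystem

end

namespace HamSystem

variable {m : ℕ}

/-! The theorem rests on the Lagrange identity (`wron_sub`). For `u` solving the system at `z̄` and
`y` solving it at `z`, `û^* J_ρ ŷ` is constant in `k`. For a single solution of (N), the increments
of the real quantity `flux` are `2 Im z` times the energy plus a term in `f`
(`flux_sub_of_isSolNonhom`).

The normalization of `Ψ` at `k₀` turns the constancy into `Û_N(z̄)^* J_ρ Û_M(z) = N^* - M`
(`hatMat_U_star_mul`). Membership in a limiting disk is a sign condition on the flux of `U v`. Being
closed, it survives on the boundary (`PlusIneq`, `MinusIneq`), and it makes `U₊ v` and `U₋ v` square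
summable at their respective ends. `flux_adjoint` carries the conditions over to `(M^*, z̄)`, and
definiteness makes `M₋ - M₊` invertible.

Existence is variation of constants. With `a(k)` the sum of `U₋(z̄)^* A f` over `ℓ ≤ k` and `b(k)`
the sum of `U₊(z̄)^* A f` over `ℓ > k`, the Green's series is the sequence with `ŷ(k) = Û₊ ω a(k) +
Û₋ ω b(k)` (`green_mulVec`, `hasSum_green`). It solves (N) because of the resolution identity
`hatMat_U_resolution`. The boundary expressions are `(M₊ - M₋) ω b(k)` and `(M₋ - M₊) ω a(k)`, which
vanish in the limit as tails of convergent series. Square summability follows by correcting `y` on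
`(-n, n]` to a solution with pure Weyl data at both ends, bounding its energy by that of `f`, and
letting `n` grow (`memL2_glue`).

For uniqueness, a homogeneous solution is `U₊ p + U₋ q`, and its boundary expressions are the
constants `(M₊ - M₋) q` and `(M₋ - M₊) p`. If `dim N(z, ±∞) = m`, the square summable solutions at
that end are exactly the `U± v`, for which the boundary expression is identically zero; so the
condition there is automatic. -/

/-! ### Matrix algebra of `I_ρ`, `J` and the initial value -/

open scoped MatrixOrder in
theorem exists_eq_conjTranspose_mul_self {n : Type*} [Fintype n] [DecidableEq n]
    {X : Matrix n n ℂ} (hX : X.PosSemidef) : ∃ C : Matrix n n ℂ, X = Cᴴ * C :=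
  CStarAlgebra.nonneg_iff_eq_star_mul_self.mp hX.nonneg

theorem posSemidef_Iρ {S : HamSystem m} (hS : S.Hyp) (k : ℤ) : (S.Iρ k).PosSemidef := by
  obtain ⟨C, hC⟩ := exists_eq_conjTranspose_mul_self (hS.ρ_pos k).posSemidef
  have : S.Iρ k = (fromBlocks C 0 0 C)ᴴ * fromBlocks C 0 0 C := by
    simp [Iρ, hC, fromBlocks_conjTranspose, fromBlocks_multiply]
  rw [this]
  exact posSemidef_conjTranspose_mul_self _

theorem isUnit_Iρ {S : HamSystem m} (hS : S.Hyp) (k : ℤ) : IsUnit (S.Iρ k) := by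
  rw [Iρ, isUnit_fromBlocks_zero₂₁]
  exact ⟨(hS.ρ_pos k).isUnit, (hS.ρ_pos k).isUnit⟩

theorem Jρ_eq_mul (S : HamSystem m) (k : ℤ) : S.Jρ k = J m * S.Iρ k := by
  simp [Jρ, Iρ, J, fromBlocks_multiply]

theorem commute_Iρ_J (S : HamSystem m) (k : ℤ) : Commute (S.Iρ k) (J m) := by
  simp [Commute, SemiconjBy, Iρ, J, fromBlocks_multiply]

theorem J_mul_J : J m * J m = -1 := by
  simp [J, fromBlocks_multiply, ← fromBlocks_one, fromBlocks_neg]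

theorem J_conjTranspose : (J m)ᴴ = -J m := by
  simp [J, fromBlocks_conjTranspose, fromBlocks_neg]

open scoped MatrixOrder in
/-- `I_ρ^{1/2}` is Hermitian, squares to `I_ρ` and commutes with `J`. -/
theorem sqrt_Iρ {S : HamSystem m} (hS : S.Hyp) (k : ℤ) :
    (CFC.sqrt (S.Iρ k))ᴴ = CFC.sqrt (S.Iρ k) ∧ CFC.sqrt (S.Iρ k) * CFC.sqrt (S.Iρ k) = S.Iρ k ∧
      CFC.sqrt (S.Iρ k) * J m = J m * CFC.sqrt (S.Iρ k) := by
  refine ⟨?_, ?_, ?_⟩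
  · exact (CFC.sqrt_nonneg (S.Iρ k)).posSemidef.isHermitian.eq
  · exact CFC.sqrt_mul_sqrt_self _ (posSemidef_Iρ hS k).nonneg
  -- The square root is a function of `I_ρ` in the functional calculus, so it commutes with whatever
  -- commutes with `I_ρ`.
  · exact (commute_Iρ_J S k).cfcₙ_nnreal _

-- Writing `R = I_ρ^{1/2}`, which commutes with `J`, the initial value is `R⁻¹ (α^* Jα^*)` and `R⁻¹
-- J I_ρ R⁻¹ = J`. What remains is `(α^* Jα^*)^* J (α^* Jα^*)`, whose blocks are read off from `αα^*
-- = 1` and `αJα^* = 0`.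
open scoped MatrixOrder in
theorem conjTranspose_mul_Jρ_mul_initial {S : HamSystem m} (hS : S.Hyp) (k₀ : ℤ)
    {α : Matrix (Fin m) (Fin m ⊕ Fin m) ℂ} (hα : IsBoundaryData α) :
    ((S.Iρ k₀)⁻¹ * fromCols (S.tilde α k₀)ᴴ (J m * (S.tilde α k₀)ᴴ))ᴴ * S.Jρ k₀ *
      ((S.Iρ k₀)⁻¹ * fromCols (S.tilde α k₀)ᴴ (J m * (S.tilde α k₀)ᴴ)) = -J m := by
  obtain ⟨hR, hRR, hRJ⟩ := sqrt_Iρ hS k₀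
  rw [tilde, show (α * CFC.sqrt (S.Iρ k₀))ᴴ = CFC.sqrt (S.Iρ k₀) * αᴴ by
    rw [conjTranspose_mul, hR], Jρ_eq_mul]
  set R := CFC.sqrt (S.Iρ k₀)
  have hu : IsUnit R := by
    have := isUnit_Iρ hS k₀
    rw [← hRR] at this
    exact isUnit_of_mul_isUnit_left this
  have hRd := (isUnit_iff_isUnit_det _).1 hu
  have h1 : (S.Iρ k₀)⁻¹ * fromCols (R * αᴴ) (J m * (R * αᴴ)) =
      R⁻¹ * fromCols αᴴ (J m * αᴴ) := by
    rw [← Matrix.mul_assoc (J m), ← hRJ, Matrix.mul_assoc R, ← mul_fromCols, ← hRR, Matrix.mul_inv_rev,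
      Matrix.mul_assoc, nonsing_inv_mul_cancel_left _ _ hRd]
  have h2 : (R⁻¹)ᴴ = R⁻¹ := by rw [conjTranspose_nonsing_inv, hR]
  have h3 : R⁻¹ * (J m * (R * R)) * R⁻¹ = J m := by
    rw [← Matrix.mul_assoc (J m), ← hRJ, Matrix.mul_assoc,
      mul_nonsing_inv_cancel_right _ _ hRd, nonsing_inv_mul_cancel_left _ _ hRd]
  obtain ⟨ha1, ha2⟩ := hα
  have hJJ : α * (J m * (J m * αᴴ)) = -1 := by
    rw [← Matrix.mul_assoc (J m), J_mul_J, Matrix.neg_mul, Matrix.one_mul, Matrix.mul_neg, ha1]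
  rw [h1, ← hRR]
  calc (R⁻¹ * fromCols αᴴ (J m * αᴴ))ᴴ * (J m * (R * R)) * (R⁻¹ * fromCols αᴴ (J m * αᴴ))
      = (fromCols αᴴ (J m * αᴴ))ᴴ * (R⁻¹ * (J m * (R * R)) * R⁻¹) * fromCols αᴴ (J m * αᴴ) := by
        rw [conjTranspose_mul, h2]; simp only [Matrix.mul_assoc]
    _ = -J m := by
        rw [h3, conjTranspose_fromCols_eq_fromRows_conjTranspose, Matrix.mul_assoc, mul_fromCols,
          fromRows_mul_fromCols, conjTranspose_mul, conjTranspose_conjTranspose, J_conjTranspose]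
        simp only [Matrix.mul_neg, Matrix.neg_mul, Matrix.mul_assoc] at *
        rw [ha2, hJJ, ← Matrix.mul_assoc (J m) (J m), J_mul_J]
        simp only [Matrix.neg_mul, Matrix.one_mul, Matrix.mul_neg, neg_neg, ha2]
        simp [J, fromBlocks_neg]

theorem star_mulVec_dotProduct {n p : Type*} [Fintype n] [Fintype p] (X : Matrix n p ℂ)
    (u : p → ℂ) (y : n → ℂ) : star (X *ᵥ u) ⬝ᵥ y = star u ⬝ᵥ (Xᴴ *ᵥ y) := by
  rw [star_mulVec, dotProduct_mulVec]

/-! ### The bilinear concomitant and its imaginary part -/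

/-- `û(k)^* J_ρ(k) ŷ(k)`. -/
def wron (S : HamSystem m) (u y : ℤ → Fin m ⊕ Fin m → ℂ) (k : ℤ) : ℂ :=
  star (hat u k) ⬝ᵥ (S.Jρ k *ᵥ hat y k)

/-- The real number `-i ŷ(k)^* J_ρ(k) ŷ(k)`. -/
def flux (S : HamSystem m) (y : ℤ → Fin m ⊕ Fin m → ℂ) (k : ℤ) : ℝ := (S.wron y y k).im

theorem Jρ_conjTranspose {S : HamSystem m} (hS : S.Hyp) (k : ℤ) : (S.Jρ k)ᴴ = -S.Jρ k := by
  simp [Jρ, fromBlocks_conjTranspose, fromBlocks_neg, (hS.ρ_pos k).isHermitian.eq]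

theorem star_wron {S : HamSystem m} (hS : S.Hyp) (u y : ℤ → Fin m ⊕ Fin m → ℂ) (k : ℤ) :
    star (S.wron u y k) = -S.wron y u k := by
  rw [wron, wron, ← star_dotProduct, star_mulVec_dotProduct, Jρ_conjTranspose hS, neg_mulVec,
    dotProduct_neg]

theorem wron_self {S : HamSystem m} (hS : S.Hyp) (y : ℤ → Fin m ⊕ Fin m → ℂ) (k : ℤ) :
    S.wron y y k = S.flux y k * Complex.I := by
  have h := congrArg Complex.re (star_wron hS y y k)
  apply Complex.ext
  · simp at h ⊢; linarith
  · simp [flux]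

/-- The Lagrange identity. The shift in `hat` is chosen so that the four `ρ`-terms on the right pair
up into values of the concomitant at `k` and at `k - 1`. -/
theorem wron_sub {S : HamSystem m} (hS : S.Hyp) (u y : ℤ → Fin m ⊕ Fin m → ℂ) (k : ℤ) :
    S.wron u y k - S.wron u y (k - 1) =
      star (u k) ⬝ᵥ S.shiftExpr y k - star (S.shiftExpr u k) ⬝ᵥ y k := by
  have e : ∀ (l : ℤ) (a b : Fin m → ℂ), star (S.ρ l *ᵥ a) ⬝ᵥ b = star a ⬝ᵥ (S.ρ l *ᵥ b) := by
    intro l a b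
    rw [star_mulVec_dotProduct, (hS.ρ_pos l).isHermitian.eq]
  have s : ∀ a b : Fin m → ℂ, star (Sum.elim a b) = Sum.elim (star a) (star b) := by
    intro a b; ext i; cases i <;> rfl
  have t : ∀ a : Fin m ⊕ Fin m → ℂ,
      a = Sum.elim (fun i => a (Sum.inl i)) (fun i => a (Sum.inr i)) := by
    intro a; ext i; cases i <;> rfl
  rw [t (u k), t (y k)]
  simp only [wron, hat, shiftExpr, Jρ, fromBlocks_mulVec, s, sumElim_dotProduct_sumElim, e,
    zero_mulVec, zero_add, add_zero, neg_mulVec, dotProduct_neg, Sum.elim_comp_inl,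
    Sum.elim_comp_inr, sub_add_cancel]
  ring

theorem shiftExpr_add (S : HamSystem m) (y w : ℤ → Fin m ⊕ Fin m → ℂ) (k : ℤ) :
    S.shiftExpr (y + w) k = S.shiftExpr y k + S.shiftExpr w k := by
  ext i
  cases i <;> simp [shiftExpr, mulVec, dotProduct, mul_add, Finset.sum_add_distrib]

theorem shiftExpr_smul (S : HamSystem m) (c : ℂ) (y : ℤ → Fin m ⊕ Fin m → ℂ) (k : ℤ) :
    S.shiftExpr (c • y) k = c • S.shiftExpr y k := by
  ext i
  cases i <;> simp [shiftExpr, mulVec, dotProduct, Finset.mul_sum, mul_left_comm]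

/-- The linear space of all solutions of the homogeneous system. -/
def solModule (S : HamSystem m) (z : ℂ) : Submodule ℂ (ℤ → Fin m ⊕ Fin m → ℂ) where
  carrier := {y | S.IsSol z y}
  add_mem' := by
    intro a b ha hb k
    rw [shiftExpr_add, ha k, hb k, Pi.add_apply, mulVec_add]
  zero_mem' := by
    intro k
    ext i
    cases i <;> simp [shiftExpr, mulVec, dotProduct]
  smul_mem' := by
    intro c a ha k
    rw [shiftExpr_smul, ha k, Pi.smul_apply, mulVec_smul]

theorem IsSolNonhom.add_isSol {S : HamSystem m} {z : ℂ} {f y w : ℤ → Fin m ⊕ Fin m → ℂ}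
    (hy : S.IsSolNonhom z f y) (hw : S.IsSol z w) : S.IsSolNonhom z f (y + w) := by
  intro k
  rw [shiftExpr_add, hy k, hw k, Pi.add_apply, mulVec_add]
  abel

theorem IsSolNonhom.sub {S : HamSystem m} {z : ℂ} {f y w : ℤ → Fin m ⊕ Fin m → ℂ}
    (hy : S.IsSolNonhom z f y) (hw : S.IsSolNonhom z f w) : S.IsSol z (y - w) := by
  intro k
  rw [sub_eq_add_neg, ← neg_one_smul ℂ w, shiftExpr_add, shiftExpr_smul, hy k, hw k, Pi.add_apply,
    Pi.smul_apply, mulVec_add, mulVec_smul]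
  module

theorem wron_sub_of_isSol {S : HamSystem m} (hS : S.Hyp) {z : ℂ}
    {u y : ℤ → Fin m ⊕ Fin m → ℂ} (hu : S.IsSol (star z) u) (hy : S.IsSol z y) (k : ℤ) :
    S.wron u y k - S.wron u y (k - 1) = 0 := by
  rw [wron_sub hS, hu k, hy k, star_mulVec_dotProduct, coeff_conjTranspose hS, sub_self]

theorem wron_eq_of_isSol {S : HamSystem m} (hS : S.Hyp) {z : ℂ}
    {u y : ℤ → Fin m ⊕ Fin m → ℂ} (hu : S.IsSol (star z) u) (hy : S.IsSol z y) (k l : ℤ) :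
    S.wron u y k = S.wron u y l := by
  have h : ∀ k, S.wron u y k = S.wron u y 0 := by
    intro k
    induction k using Int.induction_on with
    | zero => rfl
    | succ i ih =>
      have := wron_sub_of_isSol hS hu hy (i + 1)
      rw [add_sub_cancel_right, ih] at this
      exact sub_eq_zero.1 this
    | pred i ih =>
      have := wron_sub_of_isSol hS hu hy (-i)
      rw [ih] at this
      exact (sub_eq_zero.1 this).symm
  rw [h k, h l]

theorem energy_nonneg {S : HamSystem m} (hS : S.Hyp) (y : ℤ → Fin m ⊕ Fin m → ℂ) (k : ℤ) :
    0 ≤ S.energy y k :=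
  (Complex.le_def.1 ((hS.A_nonneg k).dotProduct_mulVec_nonneg (y k))).1

theorem energy_im {S : HamSystem m} (hS : S.Hyp) (y : ℤ → Fin m ⊕ Fin m → ℂ) (k : ℤ) :
    (star (y k) ⬝ᵥ (S.A k *ᵥ y k)).im = 0 :=
  ((Complex.le_def.1 ((hS.A_nonneg k).dotProduct_mulVec_nonneg (y k))).2).symm

/-- The energy balance: the Lagrange identity with `u = y`, where `zA + B` fails to be Hermitian
only by `(z̄ - z) A`. -/
theorem flux_sub_of_isSolNonhom {S : HamSystem m} (hS : S.Hyp) {z : ℂ}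
    {f y : ℤ → Fin m ⊕ Fin m → ℂ} (hy : S.IsSolNonhom z f y) (k : ℤ) :
    S.flux y k - S.flux y (k - 1) =
      2 * z.im * S.energy y k + 2 * (star (y k) ⬝ᵥ (S.A k *ᵥ f k)).im := by
  have hc : (S.coeff z k)ᴴ = S.coeff z k + (star z - z) • S.A k := by
    have := coeff_conjTranspose hS (star z) k
    rw [star_star] at this
    rw [this, coeff, coeff]
    module
  have hs : star (S.A k *ᵥ f k) ⬝ᵥ y k = star (star (y k) ⬝ᵥ (S.A k *ᵥ f k)) := by
    rw [star_dotProduct]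
  have h := congrArg Complex.im (wron_sub hS y y k)
  rw [hy k, dotProduct_add, star_add, add_dotProduct, star_mulVec_dotProduct, hc, add_mulVec,
    smul_mulVec, dotProduct_add, dotProduct_smul, hs] at h
  have hi := energy_im hS y k
  rw [flux, flux, ← Complex.sub_im, h]
  simp [energy, hi]
  ring

theorem IsSol.isSolNonhom {S : HamSystem m} {z : ℂ} {y : ℤ → Fin m ⊕ Fin m → ℂ}
    (hy : S.IsSol z y) : S.IsSolNonhom z 0 y := by
  intro k
  rw [hy k, Pi.zero_apply, mulVec_zero, add_zero]

theorem sum_Ioc_sub {G : Type*} [AddCommGroup G] (g : ℤ → G) {c d : ℤ} (h : c ≤ d) :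
    ∑ k ∈ Finset.Ioc c d, (g k - g (k - 1)) = g d - g c := by
  induction d, h using Int.leInduction with
  | base => simp
  | succ d hd ih =>
    have : Finset.Ioc c (d + 1) = insert (d + 1) (Finset.Ioc c d) := by
      ext x; simp only [Finset.mem_insert, Finset.mem_Ioc]; omega
    rw [this, Finset.sum_insert (by simp), ih, add_sub_cancel_right]
    abel

theorem flux_sub_eq_sum {S : HamSystem m} (hS : S.Hyp) {z : ℂ}
    {f y : ℤ → Fin m ⊕ Fin m → ℂ} (hy : S.IsSolNonhom z f y) {c d : ℤ} (h : c ≤ d) :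
    S.flux y d - S.flux y c = 2 * z.im * ∑ k ∈ Finset.Ioc c d, S.energy y k +
      2 * ∑ k ∈ Finset.Ioc c d, (star (y k) ⬝ᵥ (S.A k *ᵥ f k)).im := by
  rw [← sum_Ioc_sub _ h, Finset.mul_sum, Finset.mul_sum, ← Finset.sum_add_distrib]
  exact Finset.sum_congr rfl fun k _ => flux_sub_of_isSolNonhom hS hy k

theorem flux_sub_eq_sum_energy {S : HamSystem m} (hS : S.Hyp) {z : ℂ}
    {y : ℤ → Fin m ⊕ Fin m → ℂ} (hy : S.IsSol z y) {c d : ℤ} (h : c ≤ d) :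
    S.flux y d - S.flux y c = 2 * z.im * ∑ k ∈ Finset.Ioc c d, S.energy y k := by
  rw [flux_sub_eq_sum hS hy.isSolNonhom h]
  simp

/-- Cauchy–Schwarz for the semi-inner product of `A = C^* C`, followed by the weighted
arithmetic-geometric inequality. The weight `t` stays free: `1` serves for convergence, `|Im z|` for
the a priori bound. -/
theorem norm_dotProduct_le {S : HamSystem m} (hS : S.Hyp) (u f : ℤ → Fin m ⊕ Fin m → ℂ) (k : ℤ)
    {t : ℝ} (ht : 0 < t) :
    2 * ‖star (u k) ⬝ᵥ (S.A k *ᵥ f k)‖ ≤ t * S.energy u k + t⁻¹ * S.energy f k := by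
  obtain ⟨C, hC⟩ := exists_eq_conjTranspose_mul_self (hS.A_nonneg k)
  have e : ∀ a b : Fin m ⊕ Fin m → ℂ, star a ⬝ᵥ (S.A k *ᵥ b) =
      inner ℂ (WithLp.toLp 2 (C *ᵥ a)) (WithLp.toLp 2 (C *ᵥ b)) := by
    intro a b
    rw [EuclideanSpace.inner_toLp_toLp, hC, ← mulVec_mulVec, ← star_mulVec_dotProduct,
      dotProduct_comm]
  have n : ∀ a : ℤ → Fin m ⊕ Fin m → ℂ,
      S.energy a k = ‖(WithLp.toLp 2 (C *ᵥ a k) : EuclideanSpace ℂ (Fin m ⊕ Fin m))‖ ^ 2 := by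
    intro a
    rw [energy, e, inner_self_eq_norm_sq_to_K]
    norm_cast
  rw [n, n, e]
  refine (mul_le_mul_of_nonneg_left (norm_inner_le_norm _ _) (by norm_num)).trans ?_
  set a := ‖(WithLp.toLp 2 (C *ᵥ u k) : EuclideanSpace ℂ (Fin m ⊕ Fin m))‖
  set b := ‖(WithLp.toLp 2 (C *ᵥ f k) : EuclideanSpace ℂ (Fin m ⊕ Fin m))‖
  have : t * a ^ 2 + t⁻¹ * b ^ 2 - 2 * (a * b) = t⁻¹ * (t * a - b) ^ 2 := by
    field_simp; ring
  have := mul_nonneg (inv_pos.2 ht).le (sq_nonneg (t * a - b))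
  linarith

/-! ### The fundamental system and the Weyl solutions -/

theorem isSol_mulVec {n : Type*} [Fintype n] {S : HamSystem m} {z : ℂ}
    {F : ℤ → Matrix (Fin m ⊕ Fin m) n ℂ} (h : ∀ j, S.IsSol z fun k i => F k i j) (v : n → ℂ) :
    S.IsSol z fun k => F k *ᵥ v := by
  have : (fun k => F k *ᵥ v) = ∑ j, v j • fun k i => F k i j := by
    ext k i
    simp [mulVec, dotProduct, Finset.sum_apply, mul_comm]
  rw [this]
  exact (S.solModule z).sum_mem fun j _ => (S.solModule z).smul_mem _ (h j)

theorem isSol_Ψ_mulVec {S : HamSystem m} (hS : S.Hyp) (k₀ : ℤ)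
    (α : Matrix (Fin m) (Fin m ⊕ Fin m) ℂ) (z : ℂ) (x : Fin m ⊕ Fin m → ℂ) :
    S.IsSol z fun k => S.Ψ k₀ α z k *ᵥ x :=
  isSol_mulVec (fun j => isSol_ivp hS z k₀ _ j) x

theorem U_eq_mul (S : HamSystem m) (k₀ : ℤ) (α : Matrix (Fin m) (Fin m ⊕ Fin m) ℂ)
    (M : Matrix (Fin m) (Fin m) ℂ) (z : ℂ) (k : ℤ) :
    S.U k₀ α M z k = S.Ψ k₀ α z k * fromRows (1 : Matrix (Fin m) (Fin m) ℂ) M :=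
  rfl

theorem U_mulVec (S : HamSystem m) (k₀ : ℤ) (α : Matrix (Fin m) (Fin m ⊕ Fin m) ℂ)
    (M : Matrix (Fin m) (Fin m) ℂ) (z : ℂ) (v : Fin m → ℂ) :
    (fun k => S.U k₀ α M z k *ᵥ v) = fun k => S.Ψ k₀ α z k *ᵥ Sum.elim v (M *ᵥ v) := by
  ext1 k
  rw [U_eq_mul, ← mulVec_mulVec, fromRows_mulVec, one_mulVec]

theorem isSol_U_mulVec {S : HamSystem m} (hS : S.Hyp) (k₀ : ℤ)
    (α : Matrix (Fin m) (Fin m ⊕ Fin m) ℂ) (M : Matrix (Fin m) (Fin m) ℂ) (z : ℂ)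
    (v : Fin m → ℂ) : S.IsSol z fun k => S.U k₀ α M z k *ᵥ v := by
  rw [U_mulVec]
  exact isSol_Ψ_mulVec hS k₀ α z _

theorem hat_mulVec {n : Type*} [Fintype n] (F : ℤ → Matrix (Fin m ⊕ Fin m) n ℂ) (v : n → ℂ)
    (k : ℤ) : hat (fun k => F k *ᵥ v) k = hatMat F k *ᵥ v := by
  ext i
  cases i <;> rfl

theorem hatMat_U (S : HamSystem m) (k₀ : ℤ) (α : Matrix (Fin m) (Fin m ⊕ Fin m) ℂ)
    (M : Matrix (Fin m) (Fin m) ℂ) (z : ℂ) (k : ℤ) :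
    hatMat (S.U k₀ α M z) k = hatMat (S.Ψ k₀ α z) k * fromRows (1 : Matrix (Fin m) (Fin m) ℂ) M := by
  ext i j
  cases i <;> rfl

theorem wron_mulVec {n p : Type*} [Fintype n] [Fintype p] (S : HamSystem m)
    (F : ℤ → Matrix (Fin m ⊕ Fin m) n ℂ) (G : ℤ → Matrix (Fin m ⊕ Fin m) p ℂ)
    (v : n → ℂ) (w : p → ℂ) (k : ℤ) :
    S.wron (fun k => F k *ᵥ v) (fun k => G k *ᵥ w) k =
      star v ⬝ᵥ (((hatMat F k)ᴴ * S.Jρ k * hatMat G k) *ᵥ w) := by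
  rw [wron, hat_mulVec, hat_mulVec, star_mulVec_dotProduct]
  simp only [mulVec_mulVec, Matrix.mul_assoc]

theorem eq_of_star_dotProduct_mulVec {n p : Type*} [Fintype n] [Fintype p]
    {X Y : Matrix n p ℂ} (h : ∀ v w, star v ⬝ᵥ (X *ᵥ w) = star v ⬝ᵥ (Y *ᵥ w)) : X = Y := by
  classical
  ext i j
  simpa [Pi.star_single] using h (Pi.single i 1) (Pi.single j 1)

theorem hatMat_Ψ_initial (S : HamSystem m) (k₀ : ℤ) (α : Matrix (Fin m) (Fin m ⊕ Fin m) ℂ)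
    (z : ℂ) : hatMat (S.Ψ k₀ α z) k₀ =
      (S.Iρ k₀)⁻¹ * fromCols (S.tilde α k₀)ᴴ (J m * (S.tilde α k₀)ᴴ) :=
  hatMat_ivp S z k₀ _

/-- The concomitant of solutions at `z̄` and `z` does not depend on `k`, and at `k₀` it is known
from the normalization. -/
theorem hatMat_Ψ_star_mul {S : HamSystem m} (hS : S.Hyp) (k₀ : ℤ)
    {α : Matrix (Fin m) (Fin m ⊕ Fin m) ℂ} (hα : IsBoundaryData α) (z : ℂ) (k : ℤ) :
    (hatMat (S.Ψ k₀ α (star z)) k)ᴴ * S.Jρ k * hatMat (S.Ψ k₀ α z) k = -J m := by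
  rw [← conjTranspose_mul_Jρ_mul_initial hS k₀ hα]
  apply eq_of_star_dotProduct_mulVec
  intro v w
  rw [← wron_mulVec, wron_eq_of_isSol hS (isSol_Ψ_mulVec hS k₀ α _ v) (isSol_Ψ_mulVec hS k₀ α z w)
    k k₀, wron_mulVec, hatMat_Ψ_initial, hatMat_Ψ_initial]

theorem conjTranspose_fromRows_mul_J (M N : Matrix (Fin m) (Fin m) ℂ) :
    (fromRows (1 : Matrix (Fin m) (Fin m) ℂ) N)ᴴ * -J m *
      fromRows (1 : Matrix (Fin m) (Fin m) ℂ) M = Nᴴ - M := by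
  rw [conjTranspose_fromRows_eq_fromCols_conjTranspose, Matrix.mul_neg, Matrix.neg_mul,
    Matrix.mul_assoc, J, fromBlocks_mul_fromRows, fromCols_mul_fromRows]
  simp
  abel

theorem hatMat_U_star_mul {S : HamSystem m} (hS : S.Hyp) (k₀ : ℤ)
    {α : Matrix (Fin m) (Fin m ⊕ Fin m) ℂ} (hα : IsBoundaryData α)
    (M N : Matrix (Fin m) (Fin m) ℂ) (z : ℂ) (k : ℤ) :
    (hatMat (S.U k₀ α N (star z)) k)ᴴ * S.Jρ k * hatMat (S.U k₀ α M z) k = Nᴴ - M := by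
  rw [hatMat_U, hatMat_U, conjTranspose_mul, ← conjTranspose_fromRows_mul_J,
    ← hatMat_Ψ_star_mul hS k₀ hα z k]
  simp only [Matrix.mul_assoc]

theorem flux_Ψ_initial {S : HamSystem m} (hS : S.Hyp) (k₀ : ℤ)
    {α : Matrix (Fin m) (Fin m ⊕ Fin m) ℂ} (hα : IsBoundaryData α) (z : ℂ)
    (x : Fin m ⊕ Fin m → ℂ) :
    S.flux (fun k => S.Ψ k₀ α z k *ᵥ x) k₀ = (star x ⬝ᵥ (-J m *ᵥ x)).im := by
  rw [flux, wron_mulVec, hatMat_Ψ_initial, conjTranspose_mul_Jρ_mul_initial hS k₀ hα]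

theorem flux_U_initial {S : HamSystem m} (hS : S.Hyp) (k₀ : ℤ)
    {α : Matrix (Fin m) (Fin m ⊕ Fin m) ℂ} (hα : IsBoundaryData α)
    (M : Matrix (Fin m) (Fin m) ℂ) (z : ℂ) (v : Fin m → ℂ) :
    S.flux (fun k => S.U k₀ α M z k *ᵥ v) k₀ = (star v ⬝ᵥ ((Mᴴ - M) *ᵥ v)).im := by
  rw [flux, wron_mulVec, hatMat_U, hatMat_Ψ_initial, conjTranspose_mul,
    ← conjTranspose_fromRows_mul_J, ← conjTranspose_mul_Jρ_mul_initial hS k₀ hα]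
  simp only [Matrix.mul_assoc]

theorem isUnit_hatMat_Ψ {S : HamSystem m} (hS : S.Hyp) (k₀ : ℤ)
    {α : Matrix (Fin m) (Fin m ⊕ Fin m) ℂ} (hα : IsBoundaryData α) (z : ℂ) (k : ℤ) :
    IsUnit (hatMat (S.Ψ k₀ α z) k) := by
  refine IsUnit.of_mul_eq_one_right (J m * ((hatMat (S.Ψ k₀ α (star z)) k)ᴴ * S.Jρ k)) ?_
  rw [Matrix.mul_assoc, hatMat_Ψ_star_mul hS k₀ hα, Matrix.mul_neg, J_mul_J, neg_neg]

/-- The passage from `(M, z)` to `(M^*, z̄)` reverses the sign condition on the flux. -/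
theorem flux_adjoint {S : HamSystem m} (hS : S.Hyp) {k₀ : ℤ}
    {α : Matrix (Fin m) (Fin m ⊕ Fin m) ℂ} (hα : IsBoundaryData α)
    {M : Matrix (Fin m) (Fin m) ℂ} {z : ℂ} {τ : ℝ} {l : ℤ}
    (h₁ : ∀ v, τ * S.flux (fun k => S.U k₀ α M z k *ᵥ v) l ≤ 0)
    (h₂ : ∀ w, 0 ≤ τ * S.flux (fun k => S.Ψ k₀ α z k *ᵥ Sum.elim 0 w) l) (v : Fin m → ℂ) :
    0 ≤ τ * S.flux (fun k => S.U k₀ α Mᴴ (star z) k *ᵥ v) l := by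
  set u := fun k => S.U k₀ α Mᴴ (star z) k *ᵥ v with hu
  obtain ⟨x, hx⟩ : ∃ x, hatMat (S.Ψ k₀ α z) l *ᵥ x = hat u l := by
    refine ⟨(hatMat (S.Ψ k₀ α z) l)⁻¹ *ᵥ hat u l, ?_⟩
    rw [mulVec_mulVec, mul_nonsing_inv _ ((isUnit_iff_isUnit_det _).1
      (isUnit_hatMat_Ψ hS k₀ hα z l)), one_mulVec]
  set a : Fin m → ℂ := fun i => x (Sum.inl i)
  -- With this `w`, `Ψ̂ x = Û_M a + Φ̂ w` at `l`, so `û` splits into a Weyl part `ŷ` and a `Φ`-part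
  -- `p̂`.
  set w : Fin m → ℂ := (fun i => x (Sum.inr i)) - M *ᵥ a
  set y := fun k => S.U k₀ α M z k *ᵥ a with hy
  set p := fun k => S.Ψ k₀ α z k *ᵥ Sum.elim 0 w with hp
  have hdec : hat p l = hat u l - hat y l := by
    rw [hp, hy, U_mulVec, ← hx, hat_mulVec, hat_mulVec, ← mulVec_sub]
    congr 1
    ext i
    cases i <;> simp [w, a]
  -- The concomitant of `U_{M^*}(z̄)` and `U_M(z)` is `(M^*)^* - M = 0`. Hence the fluxes add up
  -- without cross terms, and the two sign assumptions bound that of `u`.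
  have horth : S.wron u y l = 0 := by
    rw [hu, hy, wron_mulVec, hatMat_U_star_mul hS k₀ hα]
    simp
  have horth' : S.wron y u l = 0 := by
    have := star_wron hS u y l
    rw [horth, star_zero] at this
    exact neg_eq_zero.1 this.symm
  have hpp : S.wron p p l = S.wron u u l + S.wron y y l := by
    have : S.wron p p l = S.wron u u l - S.wron u y l - (S.wron y u l - S.wron y y l) := by
      simp only [wron, hdec, star_sub, mulVec_sub, dotProduct_sub, sub_dotProduct]
      ring
    rw [this, horth, horth']
    ring
  have hf : S.flux p l = S.flux u l + S.flux y l := by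
    rw [flux, hpp, Complex.add_im]; rfl
  have e1 := h₁ a
  have e2 := h₂ w
  rw [← hp, hf] at e2
  rw [← hy] at e1
  linarith

/-! ### Square summability of the Weyl solutions -/

/-- The inequalities for the elements of the closure of the limiting disk at `+∞`. -/
def PlusIneq (S : HamSystem m) (k₀ : ℤ) (α : Matrix (Fin m) (Fin m ⊕ Fin m) ℂ)
    (M : Matrix (Fin m) (Fin m) ℂ) (z : ℂ) : Prop :=
  ∀ l, k₀ < l → ∀ v, z.im * S.flux (fun k => S.U k₀ α M z k *ᵥ v) l ≤ 0

/-- The inequalities for the elements of the closure of the limiting disk at `-∞`. -/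
def MinusIneq (S : HamSystem m) (k₀ : ℤ) (α : Matrix (Fin m) (Fin m ⊕ Fin m) ℂ)
    (M : Matrix (Fin m) (Fin m) ℂ) (z : ℂ) : Prop :=
  ∀ l, l < k₀ → ∀ v, 0 ≤ z.im * S.flux (fun k => S.U k₀ α M z k *ᵥ v) l

/-- The Hermitian form of `E_ℓ(M)` at `v` is `σ` times the flux of `U v` at `ℓ`. -/
theorem σ_mul_flux_nonpos {S : HamSystem m} (hS : S.Hyp) {k₀ l : ℤ}
    {α : Matrix (Fin m) (Fin m ⊕ Fin m) ℂ} {M : Matrix (Fin m) (Fin m) ℂ} {z : ℂ}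
    (hM : M ∈ S.weylDisk k₀ α z l) (v : Fin m → ℂ) :
    σ l k₀ z * S.flux (fun k => S.U k₀ α M z k *ᵥ v) l ≤ 0 := by
  have h := (Complex.le_def.1 (PosSemidef.dotProduct_mulVec_nonneg hM v)).1
  have e : star v ⬝ᵥ (S.E k₀ α z l M *ᵥ v) =
      (σ l k₀ z : ℂ) * (-Complex.I * S.wron (fun k => S.U k₀ α M z k *ᵥ v)
        (fun k => S.U k₀ α M z k *ᵥ v) l) := by
    rw [wron_mulVec, E, smul_mulVec, dotProduct_smul, Matrix.mul_smul, Matrix.smul_mul,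
      smul_mulVec, dotProduct_smul, smul_eq_mul, smul_eq_mul]
  rw [neg_mulVec, dotProduct_neg, e, wron_self hS] at h
  have e2 : -((σ l k₀ z : ℂ) * (-Complex.I * ((S.flux (fun k => S.U k₀ α M z k *ᵥ v) l : ℝ) *
      Complex.I))) = ((-(σ l k₀ z * S.flux (fun k => S.U k₀ α M z k *ᵥ v) l) : ℝ) : ℂ) := by
    push_cast
    linear_combination (σ l k₀ z * S.flux (fun k => S.U k₀ α M z k *ᵥ v) l : ℂ) * Complex.I_mul_I
  rw [e2, Complex.ofReal_re, Complex.zero_re] at h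
  linarith

/-- The flux is continuous in `M`, so sign conditions pass from a disk to its closure and hence to
its boundary. -/
theorem isClosed_flux_nonpos (S : HamSystem m) (k₀ l : ℤ)
    (α : Matrix (Fin m) (Fin m ⊕ Fin m) ℂ) (z : ℂ) (τ : ℝ) (v : Fin m → ℂ) :
    IsClosed {M | τ * S.flux (fun k => S.U k₀ α M z k *ᵥ v) l ≤ 0} := by
  refine isClosed_le (continuous_const.mul ?_) continuous_const
  have hc : Continuous fun M : Matrix (Fin m) (Fin m) ℂ =>
      hatMat (S.Ψ k₀ α z) l *ᵥ Sum.elim v (M *ᵥ v) := by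
    refine continuous_const.matrix_mulVec (continuous_pi fun i => ?_)
    cases i with
    | inl i => exact continuous_const
    | inr i => exact (continuous_apply i).comp (continuous_id.matrix_mulVec continuous_const)
  simp only [flux, wron, U_mulVec, hat_mulVec]
  exact Complex.continuous_im.comp
    (hc.star.dotProduct (continuous_const.matrix_mulVec hc))

theorem plusIneq_of_mem_frontier {S : HamSystem m} (hS : S.Hyp) {k₀ : ℤ}
    {α : Matrix (Fin m) (Fin m ⊕ Fin m) ℂ} {M : Matrix (Fin m) (Fin m) ℂ} {z : ℂ}
    (hz : z.im ≠ 0) (hM : M ∈ frontier (S.limDiskPlus k₀ α z)) : S.PlusIneq k₀ α M z := by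
  intro l hl v
  refine closure_minimal ?_ (isClosed_flux_nonpos S k₀ l α z z.im v) (frontier_subset_closure hM)
  intro N hN
  have h := σ_mul_flux_nonpos hS (Set.mem_iInter₂.1 hN l hl) v
  have hd : (0 : ℝ) < ((l - k₀ : ℤ) : ℝ) := by exact_mod_cast sub_pos.2 hl
  rw [σ, abs_mul, abs_of_pos hd, mul_div_mul_left _ _ hd.ne', div_mul_eq_mul_div] at h
  simpa using (div_le_iff₀ (abs_pos.2 hz)).1 h

theorem minusIneq_of_mem_frontier {S : HamSystem m} (hS : S.Hyp) {k₀ : ℤ}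
    {α : Matrix (Fin m) (Fin m ⊕ Fin m) ℂ} {M : Matrix (Fin m) (Fin m) ℂ} {z : ℂ}
    (hz : z.im ≠ 0) (hM : M ∈ frontier (S.limDiskMinus k₀ α z)) : S.MinusIneq k₀ α M z := by
  intro l hl v
  suffices h : -z.im * S.flux (fun k => S.U k₀ α M z k *ᵥ v) l ≤ 0 by linarith
  refine closure_minimal ?_ (isClosed_flux_nonpos S k₀ l α z (-z.im) v)
    (frontier_subset_closure hM)
  intro N hN
  have h := σ_mul_flux_nonpos hS (Set.mem_iInter₂.1 hN l hl) v
  have hd : ((l - k₀ : ℤ) : ℝ) < 0 := by exact_mod_cast sub_neg.2 hl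
  rw [σ, abs_mul, abs_of_neg hd, neg_mul, div_neg, mul_div_mul_left _ _ hd.ne, ← neg_div,
    div_mul_eq_mul_div] at h
  simpa using (div_le_iff₀ (abs_pos.2 hz)).1 h

theorem flux_Ψ_elim_zero {S : HamSystem m} (hS : S.Hyp) (k₀ : ℤ)
    {α : Matrix (Fin m) (Fin m ⊕ Fin m) ℂ} (hα : IsBoundaryData α) (z : ℂ) (w : Fin m → ℂ) :
    S.flux (fun k => S.Ψ k₀ α z k *ᵥ Sum.elim 0 w) k₀ = 0 := by
  rw [flux_Ψ_initial hS k₀ hα]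
  have s : star (Sum.elim (0 : Fin m → ℂ) w) = Sum.elim (0 : Fin m → ℂ) (star w) := by
    ext i; cases i <;> simp
  simp [J, fromBlocks_neg, fromBlocks_mulVec, s]

theorem PlusIneq.adjoint {S : HamSystem m} (hS : S.Hyp) {k₀ : ℤ}
    {α : Matrix (Fin m) (Fin m ⊕ Fin m) ℂ} (hα : IsBoundaryData α)
    {M : Matrix (Fin m) (Fin m) ℂ} {z : ℂ} (h : S.PlusIneq k₀ α M z) :
    S.PlusIneq k₀ α Mᴴ (star z) := by
  intro l hl v
  have := flux_adjoint hS hα (h l hl) (fun w => ?_) v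
  · rw [show (star z).im = -z.im from Complex.conj_im z]
    linarith
  -- The flux of `Φ w` starts from zero at `k₀`, so to the right it has the sign of `Im z`.
  · have h1 := flux_sub_eq_sum_energy hS (isSol_Ψ_mulVec hS k₀ α z (Sum.elim 0 w)) hl.le
    rw [flux_Ψ_elim_zero hS k₀ hα, sub_zero] at h1
    rw [h1]
    have := mul_nonneg (mul_self_nonneg z.im) (Finset.sum_nonneg fun k (_ : k ∈ Finset.Ioc k₀ l) =>
      energy_nonneg hS (fun k => S.Ψ k₀ α z k *ᵥ Sum.elim 0 w) k)
    linarith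

theorem MinusIneq.adjoint {S : HamSystem m} (hS : S.Hyp) {k₀ : ℤ}
    {α : Matrix (Fin m) (Fin m ⊕ Fin m) ℂ} (hα : IsBoundaryData α)
    {M : Matrix (Fin m) (Fin m) ℂ} {z : ℂ} (h : S.MinusIneq k₀ α M z) :
    S.MinusIneq k₀ α Mᴴ (star z) := by
  intro l hl v
  have := flux_adjoint (τ := -z.im) hS hα (fun v => by linarith [h l hl v]) (fun w => ?_) v
  · rwa [show (star z).im = -z.im from Complex.conj_im z]
  · have h1 := flux_sub_eq_sum_energy hS (isSol_Ψ_mulVec hS k₀ α z (Sum.elim 0 w)) hl.le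
    rw [flux_Ψ_elim_zero hS k₀ hα, zero_sub] at h1
    rw [neg_mul_comm, h1]
    have := mul_nonneg (mul_self_nonneg z.im) (Finset.sum_nonneg fun k (_ : k ∈ Finset.Ioc l k₀) =>
      energy_nonneg hS (fun k => S.Ψ k₀ α z k *ᵥ Sum.elim 0 w) k)
    linarith

theorem PlusIneq.sum_energy_le {S : HamSystem m} (hS : S.Hyp) {k₀ : ℤ}
    {α : Matrix (Fin m) (Fin m ⊕ Fin m) ℂ} {M : Matrix (Fin m) (Fin m) ℂ} {z : ℂ}
    (h : S.PlusIneq k₀ α M z) (v : Fin m → ℂ) {l : ℤ} (hl : k₀ < l) :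
    2 * z.im ^ 2 * ∑ k ∈ Finset.Ioc k₀ l, S.energy (fun k => S.U k₀ α M z k *ᵥ v) k ≤
      -(z.im * S.flux (fun k => S.U k₀ α M z k *ᵥ v) k₀) := by
  have h1 := flux_sub_eq_sum_energy hS (isSol_U_mulVec hS k₀ α M z v) hl.le
  have h2 := h l hl v
  have := congrArg (z.im * ·) h1
  simp only [mul_sub] at this
  linarith

theorem MinusIneq.sum_energy_le {S : HamSystem m} (hS : S.Hyp) {k₀ : ℤ}
    {α : Matrix (Fin m) (Fin m ⊕ Fin m) ℂ} {M : Matrix (Fin m) (Fin m) ℂ} {z : ℂ}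
    (h : S.MinusIneq k₀ α M z) (v : Fin m → ℂ) {l : ℤ} (hl : l < k₀) :
    2 * z.im ^ 2 * ∑ k ∈ Finset.Ioc l k₀, S.energy (fun k => S.U k₀ α M z k *ᵥ v) k ≤
      z.im * S.flux (fun k => S.U k₀ α M z k *ᵥ v) k₀ := by
  have h1 := flux_sub_eq_sum_energy hS (isSol_U_mulVec hS k₀ α M z v) hl.le
  have h2 := h l hl v
  have := congrArg (z.im * ·) h1
  simp only [mul_sub] at this
  linarith

theorem summable_subtype_of_sum_le {g : ℤ → ℝ} (hg : ∀ k, 0 ≤ g k) {I : Set ℤ} {C : ℝ}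
    (h : ∀ u : Finset ℤ, ↑u ⊆ I → ∃ t, u ⊆ t ∧ ∑ k ∈ t, g k ≤ C) :
    Summable fun k : I => g k := by
  refine summable_of_sum_le (c := C) (fun k => hg k) fun u => ?_
  obtain ⟨t, ht, hC⟩ := h (u.map (Function.Embedding.subtype _)) (by
    intro x hx
    obtain ⟨y, -, rfl⟩ := Finset.mem_map.1 hx
    exact y.2)
  refine le_trans ?_ hC
  refine le_trans (le_of_eq ?_) (Finset.sum_le_sum_of_subset_of_nonneg ht fun k _ _ => hg k)
  rw [Finset.sum_map]
  rfl

theorem PlusIneq.memL2 {S : HamSystem m} (hS : S.Hyp) {k₀ : ℤ}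
    {α : Matrix (Fin m) (Fin m ⊕ Fin m) ℂ} {M : Matrix (Fin m) (Fin m) ℂ} {z : ℂ}
    (hz : z.im ≠ 0) (h : S.PlusIneq k₀ α M z) (v : Fin m → ℂ) :
    S.MemL2 (Set.Ici k₀) fun k => S.U k₀ α M z k *ᵥ v := by
  refine summable_subtype_of_sum_le (energy_nonneg hS _)
    (C := S.energy (fun k => S.U k₀ α M z k *ᵥ v) k₀ +
      -(z.im * S.flux (fun k => S.U k₀ α M z k *ᵥ v) k₀) / (2 * z.im ^ 2)) fun u hu => ?_
  obtain ⟨d, hd⟩ := u.exists_le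
  -- The energy estimate omits the point `k₀`, which is therefore added separately; the maximum
  -- keeps the right end beyond `k₀`.
  refine ⟨insert k₀ (Finset.Ioc k₀ (max d (k₀ + 1))), ?_, ?_⟩
  · intro x hx
    have h1 := hd x hx
    have h2 : k₀ ≤ x := hu hx
    simp only [Finset.mem_insert, Finset.mem_Ioc]
    omega
  · rw [Finset.sum_insert (by simp)]
    gcongr
    rw [le_div_iff₀' (by positivity)]
    exact h.sum_energy_le hS v (by omega)

theorem MinusIneq.memL2 {S : HamSystem m} (hS : S.Hyp) {k₀ : ℤ}
    {α : Matrix (Fin m) (Fin m ⊕ Fin m) ℂ} {M : Matrix (Fin m) (Fin m) ℂ} {z : ℂ}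
    (hz : z.im ≠ 0) (h : S.MinusIneq k₀ α M z) (v : Fin m → ℂ) :
    S.MemL2 (Set.Iic k₀) fun k => S.U k₀ α M z k *ᵥ v := by
  refine summable_subtype_of_sum_le (energy_nonneg hS _)
    (C := z.im * S.flux (fun k => S.U k₀ α M z k *ᵥ v) k₀ / (2 * z.im ^ 2)) fun u hu => ?_
  obtain ⟨d, hd⟩ := u.finite_toSet.bddBelow
  refine ⟨Finset.Ioc (min d k₀ - 1) k₀, ?_, ?_⟩
  · intro x hx
    have h1 := hd (Finset.mem_coe.2 hx)
    have h2 : x ≤ k₀ := hu hx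
    simp only [Finset.mem_Ioc]
    omega
  · rw [le_div_iff₀' (by positivity)]
    exact h.sum_energy_le hS v (by omega)

theorem U_mulVec_ne_zero {S : HamSystem m} (hS : S.Hyp) (k₀ : ℤ)
    {α : Matrix (Fin m) (Fin m ⊕ Fin m) ℂ} (hα : IsBoundaryData α)
    (M : Matrix (Fin m) (Fin m) ℂ) (z : ℂ) {v : Fin m → ℂ} (hv : v ≠ 0) :
    (fun k => S.U k₀ α M z k *ᵥ v) ≠ 0 := by
  intro h
  apply hv
  have h1 : hatMat (S.Ψ k₀ α z) k₀ *ᵥ Sum.elim v (M *ᵥ v) = 0 := by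
    rw [← hat_mulVec, ← U_mulVec, h]
    ext i
    cases i <;> rfl
  have h2 := mulVec_injective_of_isUnit (isUnit_hatMat_Ψ hS k₀ hα z k₀) (h1.trans (mulVec_zero _).symm)
  ext i
  exact congrFun h2 (Sum.inl i)

/-- If `M₋ v = M₊ v`, then `U₊ v` and `U₋ v` have the same flux at `k₀`. The estimate to the left
gives it the weak sign of `Im z`, while the one to the right, with definiteness, gives it strictly
the opposite sign unless `v = 0`. -/
theorem isUnit_sub_of_plusIneq_of_minusIneq {S : HamSystem m} (hS : S.Hyp) {k₀ : ℤ}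
    {α : Matrix (Fin m) (Fin m ⊕ Fin m) ℂ} (hα : IsBoundaryData α)
    {Mp Mm : Matrix (Fin m) (Fin m) ℂ} {z : ℂ} (hz : z.im ≠ 0)
    (hp : S.PlusIneq k₀ α Mp z) (hm : S.MinusIneq k₀ α Mm z) : IsUnit (Mm - Mp) := by
  rw [← mulVec_injective_iff_isUnit]
  rw [← coe_mulVecLin, ← LinearMap.ker_eq_bot, LinearMap.ker_eq_bot']
  intro v hv
  by_contra hv0
  have e : Mm *ᵥ v = Mp *ᵥ v := by
    rw [mulVecLin_apply, sub_mulVec] at hv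
    exact sub_eq_zero.1 hv
  -- Definiteness needs two points to the right of `k₀`, hence `k₀ + 2`.
  have e1 := hp.sum_energy_le hS v (l := k₀ + 2) (by omega)
  have e2 := hm.sum_energy_le hS v (l := k₀ - 2) (by omega)
  have d1 := hS.definite z _ (isSol_U_mulVec hS k₀ α Mp z v)
    (U_mulVec_ne_zero hS k₀ hα Mp z hv0) (k₀ + 1) (k₀ + 2) (by omega)
  have d2 := Finset.sum_nonneg fun k (_ : k ∈ Finset.Ioc (k₀ - 2) k₀) =>
    energy_nonneg hS (fun k => S.U k₀ α Mm z k *ᵥ v) k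
  have hI : Finset.Ioc k₀ (k₀ + 2) = Finset.Icc (k₀ + 1) (k₀ + 2) := by
    ext x; simp only [Finset.mem_Ioc, Finset.mem_Icc]; omega
  rw [hI] at e1
  have hfl : S.flux (fun k => S.U k₀ α Mp z k *ᵥ v) k₀ =
      S.flux (fun k => S.U k₀ α Mm z k *ᵥ v) k₀ := by
    rw [flux_U_initial hS k₀ hα, flux_U_initial hS k₀ hα, sub_mulVec, sub_mulVec, dotProduct_sub,
      dotProduct_sub, ← star_mulVec_dotProduct, ← star_mulVec_dotProduct, e]
  rw [hfl] at e1
  have := mul_pos (by positivity : 0 < 2 * z.im ^ 2) d1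
  have := mul_nonneg (by positivity : 0 ≤ 2 * z.im ^ 2) d2
  linarith

/-! ### The resolvent identity and variation of constants -/

theorem hat_add (y w : ℤ → Fin m ⊕ Fin m → ℂ) (k : ℤ) : hat (y + w) k = hat y k + hat w k := by
  ext i
  cases i <;> rfl

theorem hat_sub (y w : ℤ → Fin m ⊕ Fin m → ℂ) (k : ℤ) : hat (y - w) k = hat y k - hat w k := by
  ext i
  cases i <;> rfl

theorem eq_of_hat_eq {y w : ℤ → Fin m ⊕ Fin m → ℂ} (h : ∀ k, hat y k = hat w k) : y = w := by
  ext k i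
  cases i with
  | inl i => exact congrFun (h k) (Sum.inl i)
  | inr i => simpa [hat] using congrFun (h (k - 1)) (Sum.inr i)

/-- The difference of the two products that make up the Green's matrix is inverse to `J_ρ`. -/
theorem hatMat_U_resolution {S : HamSystem m} (hS : S.Hyp) (k₀ : ℤ)
    {α : Matrix (Fin m) (Fin m ⊕ Fin m) ℂ} (hα : IsBoundaryData α)
    {Mp Mm : Matrix (Fin m) (Fin m) ℂ} (hω : IsUnit (Mm - Mp)) (z : ℂ) (k : ℤ) :
    (hatMat (S.U k₀ α Mp z) k * (Mm - Mp)⁻¹ * (hatMat (S.U k₀ α Mmᴴ (star z)) k)ᴴ -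
      hatMat (S.U k₀ α Mm z) k * (Mm - Mp)⁻¹ * (hatMat (S.U k₀ α Mpᴴ (star z)) k)ᴴ) *
        S.Jρ k = 1 := by
  have hd := (isUnit_iff_isUnit_det _).1 hω
  have h : ∀ M N : Matrix (Fin m) (Fin m) ℂ, (hatMat (S.U k₀ α Nᴴ (star z)) k)ᴴ * S.Jρ k *
      (hatMat (S.U k₀ α M z) k * (Mm - Mp)⁻¹) = (N - M) * (Mm - Mp)⁻¹ := by
    intro M N
    rw [← Matrix.mul_assoc, hatMat_U_star_mul hS k₀ hα, conjTranspose_conjTranspose]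
  -- The concomitants of the four pairs of Weyl solutions form the identity matrix. As both factors
  -- are square, they may be interchanged, and that product is the claim.
  have h1 : fromRows ((hatMat (S.U k₀ α Mmᴴ (star z)) k)ᴴ * S.Jρ k)
      (-((hatMat (S.U k₀ α Mpᴴ (star z)) k)ᴴ * S.Jρ k)) *
      fromCols (hatMat (S.U k₀ α Mp z) k * (Mm - Mp)⁻¹)
        (hatMat (S.U k₀ α Mm z) k * (Mm - Mp)⁻¹) = 1 := by
    rw [fromRows_mul_fromCols, Matrix.neg_mul, Matrix.neg_mul, h, h, h, h, sub_self, sub_self,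
      Matrix.zero_mul, ← Matrix.neg_mul, neg_sub, mul_nonsing_inv _ hd, neg_zero, fromBlocks_one]
  have h2 := mul_eq_one_comm.1 h1
  rw [fromCols_mul_fromRows] at h2
  rw [← h2, Matrix.sub_mul, Matrix.mul_neg, ← sub_eq_add_neg]
  simp only [Matrix.mul_assoc]

/-- At site `k` the sequence `y` takes its first block from `P` and its second from `Q`. The jump is
split so that `h` has zero first block and `h'` zero second block at `k`. Then `h` affects only the
first equation, with defect `g₁`, and `h'` only the second, with defect `g₂`. -/
theorem isSolNonhom_step_of_glue {S : HamSystem m} (hS : S.Hyp) {z : ℂ}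
    {P Q h h' y : ℤ → Fin m ⊕ Fin m → ℂ} (hP : S.IsSol z P) (hQ : S.IsSol z Q)
    (hh : S.IsSol z h) (hh' : S.IsSol z h') {k : ℤ} {g₁ g₂ : Fin m → ℂ}
    (hPQ : P k = Q k + (h k + h' k))
    (h₁ : S.Jρ k *ᵥ hat h k = Sum.elim g₁ 0)
    (h₂ : S.Jρ (k - 1) *ᵥ hat h' (k - 1) = Sum.elim (0 : Fin m → ℂ) g₂)
    (y₁ : ∀ i, y k (Sum.inl i) = P k (Sum.inl i)) (y₂ : ∀ i, y k (Sum.inr i) = Q k (Sum.inr i))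
    (y₃ : ∀ i, y (k + 1) (Sum.inr i) = P (k + 1) (Sum.inr i))
    (y₄ : ∀ i, y (k - 1) (Sum.inl i) = Q (k - 1) (Sum.inl i)) :
    S.shiftExpr y k = S.coeff z k *ᵥ y k + Sum.elim g₁ g₂ := by
  have blk : ∀ x : Fin m ⊕ Fin m → ℂ, S.coeff z k *ᵥ x = Sum.elim
      ((S.coeff z k).toBlocks₁₁ *ᵥ (x ∘ Sum.inl) + (S.coeff z k).toBlocks₁₂ *ᵥ (x ∘ Sum.inr))
      ((S.coeff z k).toBlocks₂₁ *ᵥ (x ∘ Sum.inl) + (S.coeff z k).toBlocks₂₂ *ᵥ (x ∘ Sum.inr)) := by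
    intro x
    rw [← fromBlocks_mulVec, fromBlocks_toBlocks]
  have jblk : ∀ (l : ℤ) (x : Fin m ⊕ Fin m → ℂ), S.Jρ l *ᵥ x =
      Sum.elim (S.ρ l *ᵥ (x ∘ Sum.inr)) (-(S.ρ l *ᵥ (x ∘ Sum.inl))) := by
    intro l x
    rw [Jρ, fromBlocks_mulVec]
    simp [neg_mulVec]
  have inj : ∀ (l : ℤ) (x : Fin m → ℂ), S.ρ l *ᵥ x = 0 → x = 0 := fun l x hx =>
    mulVec_injective_of_isUnit (hS.ρ_pos l).isUnit (hx.trans (mulVec_zero _).symm)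
  have sols : ∀ w, S.IsSol z w →
      S.ρ k *ᵥ (fun i => w (k + 1) (Sum.inr i)) = (S.coeff z k).toBlocks₁₁ *ᵥ (w k ∘ Sum.inl) +
        (S.coeff z k).toBlocks₁₂ *ᵥ (w k ∘ Sum.inr) ∧
      S.ρ (k - 1) *ᵥ (fun i => w (k - 1) (Sum.inl i)) =
        (S.coeff z k).toBlocks₂₁ *ᵥ (w k ∘ Sum.inl) +
        (S.coeff z k).toBlocks₂₂ *ᵥ (w k ∘ Sum.inr) := by
    intro w hw
    have := hw k
    rw [blk, shiftExpr, Sum.elim_eq_iff] at this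
    exact this
  rw [jblk, Sum.elim_eq_iff] at h₁ h₂
  have a1 : h k ∘ Sum.inl = 0 := inj k _ (neg_eq_zero.1 h₁.2)
  have a2 : h' k ∘ Sum.inr = 0 := by
    have := inj (k - 1) _ h₂.1
    ext i
    simpa [hat] using congrFun this i
  have b1 : (S.coeff z k).toBlocks₁₂ *ᵥ (h k ∘ Sum.inr) = g₁ := by
    have e := (sols h hh).1
    rw [a1, mulVec_zero, zero_add] at e
    rw [← e]
    exact h₁.1
  have b2 : (S.coeff z k).toBlocks₂₁ *ᵥ (h' k ∘ Sum.inl) = -g₂ := by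
    have e := (sols h' hh').2
    rw [a2, mulVec_zero, add_zero] at e
    rw [← e, ← h₂.2, neg_neg]
    rfl
  have p1 : P k ∘ Sum.inl = Q k ∘ Sum.inl + h' k ∘ Sum.inl := by
    have : P k ∘ Sum.inl = Q k ∘ Sum.inl + (h k ∘ Sum.inl + h' k ∘ Sum.inl) := by
      rw [hPQ]; rfl
    rw [this, a1, zero_add]
  have p2 : P k ∘ Sum.inr = Q k ∘ Sum.inr + h k ∘ Sum.inr := by
    have : P k ∘ Sum.inr = Q k ∘ Sum.inr + (h k ∘ Sum.inr + h' k ∘ Sum.inr) := by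
      rw [hPQ]; rfl
    rw [this, a2, add_zero]
  have e1 : y k ∘ Sum.inl = P k ∘ Sum.inl := funext y₁
  have e2 : y k ∘ Sum.inr = Q k ∘ Sum.inr := funext y₂
  rw [blk, shiftExpr, funext y₃, funext y₄, (sols P hP).1, (sols Q hQ).2, e1, e2, ← Sum.elim_add_add,
    Sum.elim_eq_iff]
  constructor
  · rw [p2, mulVec_add, b1, add_assoc]
  · rw [p1, mulVec_add, b2]
    abel

/-- `y` with `ŷ(k) = Û₊(k) ω a(k) + Û₋(k) ω b(k)`. -/
noncomputable def glue (S : HamSystem m) (k₀ : ℤ) (α : Matrix (Fin m) (Fin m ⊕ Fin m) ℂ)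
    (Mp Mm : Matrix (Fin m) (Fin m) ℂ) (z : ℂ) (a b : ℤ → Fin m → ℂ) (k : ℤ) :
    Fin m ⊕ Fin m → ℂ :=
  Sum.elim
    (fun i => (S.U k₀ α Mp z k *ᵥ ((Mm - Mp)⁻¹ *ᵥ a k) +
      S.U k₀ α Mm z k *ᵥ ((Mm - Mp)⁻¹ *ᵥ b k)) (Sum.inl i))
    (fun i => (S.U k₀ α Mp z k *ᵥ ((Mm - Mp)⁻¹ *ᵥ a (k - 1)) +
      S.U k₀ α Mm z k *ᵥ ((Mm - Mp)⁻¹ *ᵥ b (k - 1))) (Sum.inr i))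

theorem hat_glue (S : HamSystem m) (k₀ : ℤ) (α : Matrix (Fin m) (Fin m ⊕ Fin m) ℂ)
    (Mp Mm : Matrix (Fin m) (Fin m) ℂ) (z : ℂ) (a b : ℤ → Fin m → ℂ) (k : ℤ) :
    hat (S.glue k₀ α Mp Mm z a b) k =
      hatMat (S.U k₀ α Mp z) k *ᵥ ((Mm - Mp)⁻¹ *ᵥ a k) +
        hatMat (S.U k₀ α Mm z) k *ᵥ ((Mm - Mp)⁻¹ *ᵥ b k) := by
  ext i
  cases i with
  | inl i => rfl
  | inr i =>
    simp only [hat, glue, Sum.elim_inr, add_sub_cancel_right]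
    rfl

theorem conjTranspose_mulVec_eq_hatMat (F : ℤ → Matrix (Fin m ⊕ Fin m) (Fin m) ℂ) (k : ℤ)
    (g : Fin m ⊕ Fin m → ℂ) : (F k)ᴴ *ᵥ g =
      (hatMat F k)ᴴ *ᵥ Sum.elim (g ∘ Sum.inl) 0 +
        (hatMat F (k - 1))ᴴ *ᵥ Sum.elim (0 : Fin m → ℂ) (g ∘ Sum.inr) := by
  ext i
  simp [mulVec, dotProduct, hatMat, Fintype.sum_sum_type]

/-- Variation of constants: the jump of the coefficients at `k` is split into the contributions of
the two blocks of `A f`, attached to `hat` at `k` and at `k - 1`. -/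
theorem isSolNonhom_glue {S : HamSystem m} (hS : S.Hyp) (k₀ : ℤ)
    {α : Matrix (Fin m) (Fin m ⊕ Fin m) ℂ} (hα : IsBoundaryData α)
    {Mp Mm : Matrix (Fin m) (Fin m) ℂ} (hω : IsUnit (Mm - Mp)) (z : ℂ)
    {f : ℤ → Fin m ⊕ Fin m → ℂ} {a b : ℤ → Fin m → ℂ}
    (ha : ∀ k, a k = a (k - 1) + (S.U k₀ α Mmᴴ (star z) k)ᴴ *ᵥ (S.A k *ᵥ f k))
    (hb : ∀ k, b k = b (k - 1) - (S.U k₀ α Mpᴴ (star z) k)ᴴ *ᵥ (S.A k *ᵥ f k)) :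
    S.IsSolNonhom z f (S.glue k₀ α Mp Mm z a b) := by
  intro k
  have hsol : ∀ p q : Fin m → ℂ, S.IsSol z
      ((fun j => S.U k₀ α Mp z j *ᵥ p) + fun j => S.U k₀ α Mm z j *ᵥ q) := fun p q =>
    (S.solModule z).add_mem (isSol_U_mulVec hS k₀ α Mp z p) (isSol_U_mulVec hS k₀ α Mm z q)
  set g := S.A k *ᵥ f k with hg
  -- The homogeneous solution whose datum at `l` is `J_ρ(l)⁻¹ e`, with coefficients supplied by the
  -- resolution identity.
  let R : ℤ → (Fin m ⊕ Fin m → ℂ) → ℤ → Fin m ⊕ Fin m → ℂ := fun l e =>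
    (fun j => S.U k₀ α Mp z j *ᵥ
      ((Mm - Mp)⁻¹ *ᵥ ((hatMat (S.U k₀ α Mmᴴ (star z)) l)ᴴ *ᵥ e))) +
    fun j => S.U k₀ α Mm z j *ᵥ
      (-((Mm - Mp)⁻¹ *ᵥ ((hatMat (S.U k₀ α Mpᴴ (star z)) l)ᴴ *ᵥ e)))
  have hR : ∀ l e, S.Jρ l *ᵥ hat (R l e) l = e := by
    intro l e
    have h := mul_eq_one_comm.1 (hatMat_U_resolution hS k₀ hα hω z l)
    simp only [R]
    rw [hat_add, hat_mulVec, hat_mulVec, mulVec_neg, ← sub_eq_add_neg]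
    simp only [mulVec_mulVec, ← sub_mulVec]
    rw [← Matrix.mul_assoc, ← Matrix.mul_assoc, h, one_mulVec]
  have key := isSolNonhom_step_of_glue hS
    (y := S.glue k₀ α Mp Mm z a b) (k := k) (g₁ := g ∘ Sum.inl) (g₂ := g ∘ Sum.inr)
    (hsol ((Mm - Mp)⁻¹ *ᵥ a k) ((Mm - Mp)⁻¹ *ᵥ b k))
    (hsol ((Mm - Mp)⁻¹ *ᵥ a (k - 1)) ((Mm - Mp)⁻¹ *ᵥ b (k - 1)))
    (h := R k (Sum.elim (g ∘ Sum.inl) 0)) (h' := R (k - 1) (Sum.elim (0 : Fin m → ℂ) (g ∘ Sum.inr)))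
    (hsol _ _) (hsol _ _) ?_ (hR _ _) (hR _ _) (fun i => rfl) (fun i => rfl) ?_ (fun i => rfl)
  · rw [key, Sum.elim_comp_inl_inr]
  · simp only [R, Pi.add_apply]
    rw [ha k, hb k, conjTranspose_mulVec_eq_hatMat (S.U k₀ α Mmᴴ (star z)),
      conjTranspose_mulVec_eq_hatMat (S.U k₀ α Mpᴴ (star z))]
    simp only [mulVec_add, mulVec_sub, mulVec_neg]
    abel
  · intro i
    simp only [glue, Sum.elim_inr, add_sub_cancel_right]
    rfl

/-! ### Boundary conditions and uniqueness -/

theorem hatMat_U_star_mulVec_hat {S : HamSystem m} (hS : S.Hyp) (k₀ : ℤ)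
    {α : Matrix (Fin m) (Fin m ⊕ Fin m) ℂ} (hα : IsBoundaryData α)
    (Mp Mm N : Matrix (Fin m) (Fin m) ℂ) (z : ℂ) {y : ℤ → Fin m ⊕ Fin m → ℂ} {k : ℤ}
    {p q : Fin m → ℂ}
    (hy : hat y k = hatMat (S.U k₀ α Mp z) k *ᵥ p + hatMat (S.U k₀ α Mm z) k *ᵥ q) :
    (hatMat (S.U k₀ α Nᴴ (star z)) k)ᴴ *ᵥ (S.Jρ k *ᵥ hat y k) =
      (N - Mp) *ᵥ p + (N - Mm) *ᵥ q := by
  rw [hy]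
  simp only [mulVec_add, mulVec_mulVec]
  rw [← Matrix.mul_assoc, ← Matrix.mul_assoc, hatMat_U_star_mul hS k₀ hα,
    hatMat_U_star_mul hS k₀ hα, conjTranspose_conjTranspose]

theorem hatMat_U_star_mulVec_hat_const {S : HamSystem m} (hS : S.Hyp) (k₀ : ℤ)
    (α : Matrix (Fin m) (Fin m ⊕ Fin m) ℂ) (N : Matrix (Fin m) (Fin m) ℂ) {z : ℂ}
    {y : ℤ → Fin m ⊕ Fin m → ℂ} (hy : S.IsSol z y) (k l : ℤ) :
    (hatMat (S.U k₀ α N (star z)) k)ᴴ *ᵥ (S.Jρ k *ᵥ hat y k) =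
      (hatMat (S.U k₀ α N (star z)) l)ᴴ *ᵥ (S.Jρ l *ᵥ hat y l) := by
  ext i
  have := wron_eq_of_isSol hS (isSol_U_mulVec hS k₀ α N (star z) (Pi.single i 1)) hy k l
  simpa only [wron, hat_mulVec, star_mulVec_dotProduct, Pi.star_single, star_one,
    single_one_dotProduct] using this

/-- Every solution of the homogeneous system is `U₊ p + U₋ q`. -/
theorem IsSol.exists_eq {S : HamSystem m} (hS : S.Hyp) (k₀ : ℤ)
    {α : Matrix (Fin m) (Fin m ⊕ Fin m) ℂ} (hα : IsBoundaryData α)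
    {Mp Mm : Matrix (Fin m) (Fin m) ℂ} (hω : IsUnit (Mm - Mp)) {z : ℂ}
    {y : ℤ → Fin m ⊕ Fin m → ℂ} (hy : S.IsSol z y) :
    ∃ p q, y = (fun k => S.U k₀ α Mp z k *ᵥ p) + fun k => S.U k₀ α Mm z k *ᵥ q := by
  refine ⟨(Mm - Mp)⁻¹ *ᵥ ((hatMat (S.U k₀ α Mmᴴ (star z)) 0)ᴴ *ᵥ (S.Jρ 0 *ᵥ hat y 0)),
    -((Mm - Mp)⁻¹ *ᵥ ((hatMat (S.U k₀ α Mpᴴ (star z)) 0)ᴴ *ᵥ (S.Jρ 0 *ᵥ hat y 0))), ?_⟩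
  apply eq_of_hat_eq
  intro k
  have h := congrArg (· *ᵥ hat y k) (hatMat_U_resolution hS k₀ hα hω z k)
  simp only [one_mulVec] at h
  -- The coefficients, computed at `0`, are constant and may be moved to `k`, where the resolution
  -- identity reproduces `ŷ(k)`.
  rw [hat_add, hat_mulVec, hat_mulVec, hatMat_U_star_mulVec_hat_const hS k₀ α Mmᴴ hy 0 k,
    hatMat_U_star_mulVec_hat_const hS k₀ α Mpᴴ hy 0 k, mulVec_neg, ← sub_eq_add_neg]
  simp only [mulVec_mulVec, ← sub_mulVec]
  rw [← Matrix.mul_assoc, ← Matrix.mul_assoc, ← Matrix.mul_assoc, ← Matrix.mul_assoc,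
    ← Matrix.sub_mul, h]

theorem BC.sub {S : HamSystem m} {k₀ : ℤ} {α : Matrix (Fin m) (Fin m ⊕ Fin m) ℂ}
    {M : Matrix (Fin m) (Fin m) ℂ} {z : ℂ} {F : Filter ℤ} {y w : ℤ → Fin m ⊕ Fin m → ℂ}
    (hy : S.BC k₀ α M z F y) (hw : S.BC k₀ α M z F w) : S.BC k₀ α M z F (y - w) := by
  have := Tendsto.sub hy hw
  simp only [← mulVec_sub, ← hat_sub, sub_zero] at this
  exact this

theorem BC.add {S : HamSystem m} {k₀ : ℤ} {α : Matrix (Fin m) (Fin m ⊕ Fin m) ℂ}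
    {M : Matrix (Fin m) (Fin m) ℂ} {z : ℂ} {F : Filter ℤ} {y w : ℤ → Fin m ⊕ Fin m → ℂ}
    (hy : S.BC k₀ α M z F y) (hw : S.BC k₀ α M z F w) : S.BC k₀ α M z F (y + w) := by
  have := Tendsto.add hy hw
  simp only [← mulVec_add, ← hat_add, add_zero] at this
  exact this

theorem BC_U_mulVec {S : HamSystem m} (hS : S.Hyp) (k₀ : ℤ)
    {α : Matrix (Fin m) (Fin m ⊕ Fin m) ℂ} (hα : IsBoundaryData α)
    (M : Matrix (Fin m) (Fin m) ℂ) (z : ℂ) (F : Filter ℤ) (v : Fin m → ℂ) :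
    S.BC k₀ α M z F fun k => S.U k₀ α M z k *ᵥ v := by
  have : ∀ k, (hatMat (S.U k₀ α Mᴴ (star z)) k)ᴴ *ᵥ
      (S.Jρ k *ᵥ hat (fun k => S.U k₀ α M z k *ᵥ v) k) = 0 := by
    intro k
    rw [hat_mulVec, mulVec_mulVec, mulVec_mulVec, hatMat_U_star_mul hS k₀ hα,
      conjTranspose_conjTranspose, sub_self, zero_mulVec]
  simp only [BC, this]
  exact tendsto_const_nhds

theorem IsSol.eq_zero_of_BC {S : HamSystem m} (hS : S.Hyp) (k₀ : ℤ)
    {α : Matrix (Fin m) (Fin m ⊕ Fin m) ℂ} (hα : IsBoundaryData α)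
    {Mp Mm : Matrix (Fin m) (Fin m) ℂ} (hω : IsUnit (Mm - Mp)) {z : ℂ}
    {y : ℤ → Fin m ⊕ Fin m → ℂ} (hy : S.IsSol z y) (hp : S.BC k₀ α Mp z atTop y)
    (hm : S.BC k₀ α Mm z atBot y) : y = 0 := by
  obtain ⟨p, q, rfl⟩ := hy.exists_eq hS k₀ hα hω
  have hh : ∀ k, hat ((fun k => S.U k₀ α Mp z k *ᵥ p) + fun k => S.U k₀ α Mm z k *ᵥ q) k =
      hatMat (S.U k₀ α Mp z) k *ᵥ p + hatMat (S.U k₀ α Mm z) k *ᵥ q := by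
    intro k
    rw [hat_add, hat_mulVec, hat_mulVec]
  have hω' : IsUnit (Mp - Mm) := by
    rw [← neg_sub]
    exact hω.neg
  simp only [BC, hatMat_U_star_mulVec_hat hS k₀ hα Mp Mm _ z (hh _), sub_self, zero_mulVec,
    zero_add, add_zero, tendsto_const_nhds_iff] at hp hm
  have hq0 : q = 0 := mulVec_injective_of_isUnit hω' (hp.trans (mulVec_zero _).symm)
  have hp0 : p = 0 := mulVec_injective_of_isUnit hω (hm.trans (mulVec_zero _).symm)
  ext k i
  simp [hp0, hq0]

/-- If the solutions in `ℓ²_A(I)` form a space of dimension `m`, it consists of the columns of a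
Weyl solution that is in `ℓ²_A(I)`. -/
theorem exists_eq_U_mulVec_of_finrank {S : HamSystem m} (hS : S.Hyp) (k₀ : ℤ)
    {α : Matrix (Fin m) (Fin m ⊕ Fin m) ℂ} (hα : IsBoundaryData α)
    {Mp Mm : Matrix (Fin m) (Fin m) ℂ} (hω : IsUnit (Mm - Mp)) {z : ℂ} {I : Set ℤ}
    (hdim : Set.finrank ℂ (S.solSpace z I) = m) {M : Matrix (Fin m) (Fin m) ℂ}
    (hM : ∀ v, S.MemL2 I fun k => S.U k₀ α M z k *ᵥ v)
    {y : ℤ → Fin m ⊕ Fin m → ℂ} (hy : S.IsSol z y) (hyI : S.MemL2 I y) :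
    ∃ v, y = fun k => S.U k₀ α M z k *ᵥ v := by
  let L : Matrix (Fin m) (Fin m) ℂ → (Fin m → ℂ) →ₗ[ℂ] (ℤ → Fin m ⊕ Fin m → ℂ) := fun N =>
    LinearMap.pi fun k => mulVecLin (S.U k₀ α N z k)
  have hL : ∀ N v, L N v = fun k => S.U k₀ α N z k *ᵥ v := fun N v => rfl
  have hinj : Function.Injective (L M) := by
    rw [← LinearMap.ker_eq_bot, LinearMap.ker_eq_bot']
    intro v hv
    by_contra hv0
    exact U_mulVec_ne_zero hS k₀ hα M z hv0 hv
  -- Comparing dimensions of nested spaces needs the larger one finite-dimensional; every solution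
  -- has the form `U₊ p + U₋ q`.
  have hfin : FiniteDimensional ℂ (Submodule.span ℂ (S.solSpace z I)) := by
    refine Submodule.finiteDimensional_of_le
      (S₂ := LinearMap.range (L Mp) ⊔ LinearMap.range (L Mm)) (Submodule.span_le.2 ?_)
    intro w hw
    obtain ⟨p, q, rfl⟩ := IsSol.exists_eq hS k₀ hα hω hw.1
    exact Submodule.add_mem_sup ⟨p, rfl⟩ ⟨q, rfl⟩
  have hle : LinearMap.range (L M) ≤ Submodule.span ℂ (S.solSpace z I) := by
    rintro _ ⟨v, rfl⟩
    exact Submodule.subset_span ⟨isSol_U_mulVec hS k₀ α M z v, hM v⟩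
  have heq := Submodule.eq_of_le_of_finrank_eq hle (by
    rw [LinearMap.finrank_range_of_inj hinj, Module.finrank_fin_fun]
    exact hdim.symm)
  have hmem : y ∈ LinearMap.range (L M) := heq ▸ Submodule.subset_span ⟨hy, hyI⟩
  obtain ⟨v, hv⟩ := hmem
  exact ⟨v, hv.symm⟩

/-! ### Convergence of the Green's series -/

theorem memL2_univ_iff {S : HamSystem m} {y : ℤ → Fin m ⊕ Fin m → ℂ} :
    S.MemL2 Set.univ y ↔ Summable (S.energy y) := by
  have := summable_subtype_iff_indicator (f := S.energy y) (s := Set.univ)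
  rw [Set.indicator_univ] at this
  exact this

theorem MemL2.of_univ {S : HamSystem m} {y : ℤ → Fin m ⊕ Fin m → ℂ} (h : S.MemL2 Set.univ y)
    (I : Set ℤ) : S.MemL2 I y :=
  (memL2_univ_iff.1 h).subtype I

theorem MemL2.sub {S : HamSystem m} (hS : S.Hyp) {I : Set ℤ} {y w : ℤ → Fin m ⊕ Fin m → ℂ}
    (hy : S.MemL2 I y) (hw : S.MemL2 I w) : S.MemL2 I (y - w) := by
  refine Summable.of_nonneg_of_le (fun k => energy_nonneg hS _ _) (fun k => ?_)
    ((hy.add hw).mul_left 2)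
  have h := energy_nonneg hS (y + w) k
  have e : S.energy (y + w) k + S.energy (y - w) k = 2 * (S.energy y k + S.energy w k) := by
    simp only [energy, Pi.add_apply, Pi.sub_apply, star_add, star_sub, mulVec_add, mulVec_sub,
      dotProduct_add, dotProduct_sub, add_dotProduct, sub_dotProduct, Complex.add_re,
      Complex.sub_re]
    ring
  linarith

theorem summable_indicator_conjTranspose_mulVec {S : HamSystem m} (hS : S.Hyp)
    {F : ℤ → Matrix (Fin m ⊕ Fin m) (Fin m) ℂ} {I I' : Set ℤ}
    (hF : ∀ v, S.MemL2 I fun k => F k *ᵥ v) {f : ℤ → Fin m ⊕ Fin m → ℂ}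
    (hf : S.MemL2 Set.univ f) (hI : (I' \ I).Finite) :
    Summable (I'.indicator fun k => (F k)ᴴ *ᵥ (S.A k *ᵥ f k)) := by
  have h1 : Summable (I.indicator fun k => (F k)ᴴ *ᵥ (S.A k *ᵥ f k)) := by
    rw [← summable_subtype_iff_indicator, Pi.summable]
    intro i
    refine Summable.of_norm_bounded (((hF (Pi.single i 1)).add (hf.of_univ I)).mul_left (1 / 2))
      fun k => ?_
    have := norm_dotProduct_le hS (fun k => F k *ᵥ Pi.single i 1) f k one_pos
    rw [star_mulVec_dotProduct, Pi.star_single, star_one, single_one_dotProduct, inv_one, one_mul,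
      one_mul] at this
    simp only [Function.comp_apply]
    linarith
  -- The finitely many points of `I'` outside `I` do not affect summability.
  refine (h1.indicator I').congr_cofinite ?_
  filter_upwards [hI.compl_mem_cofinite] with k hk
  by_cases hk' : k ∈ I'
  · have : k ∈ I := by_contra fun h => hk ⟨hk', h⟩
    rw [Set.indicator_of_mem hk', Set.indicator_of_mem this, Set.indicator_of_mem hk']
  · rw [Set.indicator_of_notMem hk', Set.indicator_of_notMem hk']

theorem tendsto_tsum_indicator {E ι : Type*} [NormedAddCommGroup E] [NormedSpace ℝ E]
    [FiniteDimensional ℝ E] {F : Filter ι} {I : ι → Set ℤ} {I₀ : Set ℤ} {g : ℤ → E}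
    (hg : Summable (I₀.indicator g)) (hI : ∀ᶠ i in F, I i ⊆ I₀)
    (hl : ∀ l, ∀ᶠ i in F, l ∉ I i) :
    Tendsto (fun i => ∑' l, (I i).indicator g l) F (𝓝 0) := by
  rw [← tsum_zero (α := E) (β := ℤ)]
  refine tendsto_tsum_of_dominated_convergence hg.norm (fun l => ?_) ?_
  · refine tendsto_const_nhds.congr' ?_
    filter_upwards [hl l] with i hi
    rw [Set.indicator_of_notMem hi]
  · filter_upwards [hI] with i hi l
    by_cases h : l ∈ I i
    · rw [Set.indicator_of_mem h, Set.indicator_of_mem (hi h)]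
    · rw [Set.indicator_of_notMem h, norm_zero]
      exact norm_nonneg _

theorem hasSum_mulVec {n p ι : Type*} [Fintype p] {g : ι → p → ℂ} {s : p → ℂ}
    (h : HasSum g s) (X : Matrix n p ℂ) : HasSum (fun l => X *ᵥ g l) (X *ᵥ s) :=
  h.map (mulVecLin X) (continuous_const.matrix_mulVec continuous_id)

/-- On the diagonal the upper block row of `K` is that of the case `k > ℓ` and the lower one that of
`k < ℓ`. This matches the second block of `glue` using its coefficients at `k - 1`. -/
theorem green_mulVec (S : HamSystem m) (k₀ : ℤ) (α : Matrix (Fin m) (Fin m ⊕ Fin m) ℂ)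
    (Mp Mm : Matrix (Fin m) (Fin m) ℂ) (z : ℂ) (w : ℤ → Fin m ⊕ Fin m → ℂ) (k l : ℤ) :
    S.green k₀ α Mp Mm z k l *ᵥ w l = S.glue k₀ α Mp Mm z
      (fun k => (Set.Iic k).indicator (fun l => (S.U k₀ α Mmᴴ (star z) l)ᴴ *ᵥ w l) l)
      (fun k => (Set.Ioi k).indicator (fun l => (S.U k₀ α Mpᴴ (star z) l)ᴴ *ᵥ w l) l) k := by
  have hcol : ∀ (X : Matrix (Fin m ⊕ Fin m) (Fin m) ℂ) (v : Fin m ⊕ Fin m → ℂ),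
      Xᴴ *ᵥ v = X.toRows₁ᴴ *ᵥ (v ∘ Sum.inl) + X.toRows₂ᴴ *ᵥ (v ∘ Sum.inr) := by
    intro X v
    ext i
    simp [mulVec, dotProduct, Fintype.sum_sum_type]
  rcases lt_trichotomy l k with h | h | h
  · rw [green, if_pos h, glue]
    simp only [Set.mem_Iic, Set.mem_Ioi, h.le, Int.le_sub_one_of_lt h, h.not_gt,
      (Int.le_sub_one_of_lt h).not_gt, Set.indicator_of_mem, Set.indicator_of_notMem,
      not_false_eq_true, mulVec_zero, add_zero]
    ext i
    cases i <;> simp [← mulVec_mulVec]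
  · subst h
    rw [green, if_neg (lt_irrefl _), if_neg (lt_irrefl _), glue, fromBlocks_mulVec]
    have h1 : l ∈ Set.Iic l := Set.self_mem_Iic
    have h2 : l ∉ Set.Ioi l := Set.self_notMem_Ioi
    have h3 : l ∉ Set.Iic (l - 1) := by simp
    have h4 : l ∈ Set.Ioi (l - 1) := by simp
    simp only [h1, h2, h3, h4, Set.indicator_of_mem, Set.indicator_of_notMem,
      not_false_eq_true, mulVec_zero, add_zero, zero_add, hcol, mulVec_add,
      ← mulVec_mulVec]
    rfl
  · rw [green, if_neg h.not_gt, if_pos h, glue]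
    have h1 : l ∉ Set.Iic k := by simpa using h
    have h2 : l ∈ Set.Ioi k := h
    have h3 : l ∉ Set.Iic (k - 1) := by simp; omega
    have h4 : l ∈ Set.Ioi (k - 1) := by simp; omega
    simp only [h1, h2, h3, h4, Set.indicator_of_mem, Set.indicator_of_notMem,
      not_false_eq_true, mulVec_zero, zero_add]
    ext i
    cases i <;> simp [← mulVec_mulVec]

theorem hasSum_green {S : HamSystem m} {k₀ : ℤ} {α : Matrix (Fin m) (Fin m ⊕ Fin m) ℂ}
    {Mp Mm : Matrix (Fin m) (Fin m) ℂ} {z : ℂ} {w : ℤ → Fin m ⊕ Fin m → ℂ} {a b : ℤ → Fin m → ℂ}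
    (ha : ∀ k, HasSum ((Set.Iic k).indicator fun l => (S.U k₀ α Mmᴴ (star z) l)ᴴ *ᵥ w l) (a k))
    (hb : ∀ k, HasSum ((Set.Ioi k).indicator fun l => (S.U k₀ α Mpᴴ (star z) l)ᴴ *ᵥ w l) (b k))
    (k : ℤ) : HasSum (fun l => S.green k₀ α Mp Mm z k l *ᵥ w l) (S.glue k₀ α Mp Mm z a b k) := by
  have h : ∀ j, HasSum (fun l =>
      S.U k₀ α Mp z k *ᵥ ((Mm - Mp)⁻¹ *ᵥ
        (Set.Iic j).indicator (fun l => (S.U k₀ α Mmᴴ (star z) l)ᴴ *ᵥ w l) l) +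
      S.U k₀ α Mm z k *ᵥ ((Mm - Mp)⁻¹ *ᵥ
        (Set.Ioi j).indicator (fun l => (S.U k₀ α Mpᴴ (star z) l)ᴴ *ᵥ w l) l))
      (S.U k₀ α Mp z k *ᵥ ((Mm - Mp)⁻¹ *ᵥ a j) + S.U k₀ α Mm z k *ᵥ ((Mm - Mp)⁻¹ *ᵥ b j)) :=
    fun j => (hasSum_mulVec (hasSum_mulVec (ha j) _) _).add
      (hasSum_mulVec (hasSum_mulVec (hb j) _) _)
  simp only [green_mulVec]
  refine Pi.hasSum.2 fun i => ?_
  cases i with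
  | inl i => exact Pi.hasSum.1 (h k) (Sum.inl i)
  | inr i => exact Pi.hasSum.1 (h (k - 1)) (Sum.inr i)

theorem tsum_indicator_Iic {E : Type*} [NormedAddCommGroup E] {g : ℤ → E} {k : ℤ}
    (h : Summable ((Set.Iic (k - 1)).indicator g)) :
    ∑' l, (Set.Iic k).indicator g l = ∑' l, (Set.Iic (k - 1)).indicator g l + g k := by
  have e : (Set.Iic k).indicator g = (Set.Iic (k - 1)).indicator g + Pi.single k (g k) := by
    ext l
    rcases lt_trichotomy l k with h | rfl | h
    · simp [Set.indicator, h.le, Int.le_sub_one_of_lt h, h.ne]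
    · simp [Set.indicator]
    · simp [Set.indicator, h.ne', h.not_ge, show ¬ l ≤ k - 1 by omega]
  rw [e]
  have := h.hasSum.add (hasSum_pi_single k (g k))
  exact this.tsum_eq

theorem tsum_indicator_Ioi {E : Type*} [NormedAddCommGroup E] {g : ℤ → E} {k : ℤ}
    (h : Summable ((Set.Ioi k).indicator g)) :
    ∑' l, (Set.Ioi k).indicator g l = ∑' l, (Set.Ioi (k - 1)).indicator g l - g k := by
  have e : (Set.Ioi (k - 1)).indicator g = (Set.Ioi k).indicator g + Pi.single k (g k) := by
    ext l
    rcases lt_trichotomy l k with h | rfl | h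
    · simp [Set.indicator, h.not_gt, h.ne, show ¬ k - 1 < l by omega]
    · simp [Set.indicator]
    · simp [Set.indicator, h, h.ne', show k - 1 < l by omega]
  rw [e]
  have := h.hasSum.add (hasSum_pi_single k (g k))
  rw [eq_sub_iff_add_eq]
  exact this.tsum_eq.symm

/-! ### The a priori bound -/

/-- With favourable signs at both ends the boundary terms of the energy balance can be dropped. The
mixed term, with weight `|Im z|`, costs half of the energy of `y`. -/
theorem sum_energy_le_of_flux {S : HamSystem m} (hS : S.Hyp) {z : ℂ}
    {f y : ℤ → Fin m ⊕ Fin m → ℂ} (hz : z.im ≠ 0) (hy : S.IsSolNonhom z f y) {c d : ℤ}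
    (hcd : c ≤ d) (hd : z.im * S.flux y d ≤ 0) (hc : 0 ≤ z.im * S.flux y c) :
    z.im ^ 2 * ∑ k ∈ Finset.Ioc c d, S.energy y k ≤ ∑ k ∈ Finset.Ioc c d, S.energy f k := by
  have h := congrArg (z.im * ·) (flux_sub_eq_sum hS hy hcd)
  simp only [mul_sub, mul_add] at h
  have hb : -(z.im * (2 * ∑ k ∈ Finset.Ioc c d, (star (y k) ⬝ᵥ (S.A k *ᵥ f k)).im)) ≤
      z.im ^ 2 * ∑ k ∈ Finset.Ioc c d, S.energy y k + ∑ k ∈ Finset.Ioc c d, S.energy f k := by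
    rw [Finset.mul_sum, Finset.mul_sum, ← Finset.sum_neg_distrib, Finset.mul_sum,
      ← Finset.sum_add_distrib]
    refine Finset.sum_le_sum fun k _ => ?_
    have hp := abs_pos.2 hz
    have h1 := mul_le_mul_of_nonneg_left (norm_dotProduct_le hS y f k hp) hp.le
    have h2 : |z.im| * (|z.im| * S.energy y k + |z.im|⁻¹ * S.energy f k) =
        z.im ^ 2 * S.energy y k + S.energy f k := by
      rw [← sq_abs]
      field_simp
    rw [h2] at h1
    refine le_trans ?_ h1
    refine (neg_le_abs _).trans ?_
    rw [abs_mul, abs_mul, abs_two]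
    gcongr
    exact Complex.abs_im_le_norm _
  linarith

theorem flux_congr {S : HamSystem m} {y w : ℤ → Fin m ⊕ Fin m → ℂ} {k : ℤ}
    (h : hat y k = hat w k) : S.flux y k = S.flux w k := by
  rw [flux, flux, wron, wron, h]

/-- Approximations `Y n → y` satisfy an energy bound on `(-n, n]` uniform in `n`, which passes to
finite sums for `y` as in Fatou's lemma. -/
theorem memL2_glue {S : HamSystem m} (hS : S.Hyp) {k₀ : ℤ}
    {α : Matrix (Fin m) (Fin m ⊕ Fin m) ℂ} {Mp Mm : Matrix (Fin m) (Fin m) ℂ} {z : ℂ}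
    (hz : z.im ≠ 0) (hp : S.PlusIneq k₀ α Mp z) (hm : S.MinusIneq k₀ α Mm z)
    {f : ℤ → Fin m ⊕ Fin m → ℂ} (hf : S.MemL2 Set.univ f) {a b : ℤ → Fin m → ℂ}
    (hy : S.IsSolNonhom z f (S.glue k₀ α Mp Mm z a b))
    (ha : Tendsto a atBot (𝓝 0)) (hb : Tendsto b atTop (𝓝 0)) :
    S.MemL2 Set.univ (S.glue k₀ α Mp Mm z a b) := by
  rw [memL2_univ_iff] at hf
  set y := S.glue k₀ α Mp Mm z a b with hydef
  -- The homogeneous correction cancels the `U₋`-part at `n` and the `U₊`-part at `-n`. The flux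
  -- then has the sign required at each end, provided `-n < k₀ < n`.
  let Y : ℤ → ℤ → Fin m ⊕ Fin m → ℂ := fun n => y +
    ((fun k => S.U k₀ α Mp z k *ᵥ -((Mm - Mp)⁻¹ *ᵥ a (-n))) +
      fun k => S.U k₀ α Mm z k *ᵥ -((Mm - Mp)⁻¹ *ᵥ b n))
  have hYsol : ∀ n, S.IsSolNonhom z f (Y n) := fun n => hy.add_isSol
    ((S.solModule z).add_mem (isSol_U_mulVec hS k₀ α Mp z _) (isSol_U_mulVec hS k₀ α Mm z _))
  have hYhat : ∀ n k, hat (Y n) k =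
      hatMat (S.U k₀ α Mp z) k *ᵥ ((Mm - Mp)⁻¹ *ᵥ a k - (Mm - Mp)⁻¹ *ᵥ a (-n)) +
        hatMat (S.U k₀ α Mm z) k *ᵥ ((Mm - Mp)⁻¹ *ᵥ b k - (Mm - Mp)⁻¹ *ᵥ b n) := by
    intro n k
    simp only [Y]
    rw [hat_add, hat_add, hat_mulVec, hat_mulVec, hydef, hat_glue]
    simp only [mulVec_neg, mulVec_sub]
    abel
  have hYbound : ∀ n, |k₀| < n →
      z.im ^ 2 * ∑ k ∈ Finset.Ioc (-n) n, S.energy (Y n) k ≤ ∑' k, S.energy f k := by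
    intro n hn
    have hn' := abs_lt.1 hn
    refine (sum_energy_le_of_flux hS hz (hYsol n) (by omega) ?_ ?_).trans
      (hf.sum_le_tsum _ fun k _ => energy_nonneg hS f k)
    · rw [flux_congr (w := fun k => S.U k₀ α Mp z k *ᵥ
        ((Mm - Mp)⁻¹ *ᵥ a n - (Mm - Mp)⁻¹ *ᵥ a (-n)))]
      · exact hp n hn'.2 _
      · rw [hYhat, hat_mulVec, sub_self, mulVec_zero, add_zero]
    · rw [flux_congr (w := fun k => S.U k₀ α Mm z k *ᵥ
        ((Mm - Mp)⁻¹ *ᵥ b (-n) - (Mm - Mp)⁻¹ *ᵥ b n))]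
      · exact hm (-n) hn'.1 _
      · rw [hYhat, hat_mulVec, sub_self, mulVec_zero, zero_add]
  have hcont : ∀ (X : Matrix (Fin m ⊕ Fin m) (Fin m) ℂ) {c : ℤ → Fin m → ℂ},
      Tendsto c atTop (𝓝 0) →
      Tendsto (fun n => X *ᵥ -((Mm - Mp)⁻¹ *ᵥ c n)) atTop (𝓝 0) := by
    intro X c hc
    have h : Continuous fun x : Fin m → ℂ => X *ᵥ -((Mm - Mp)⁻¹ *ᵥ x) :=
      continuous_const.matrix_mulVec (continuous_const.matrix_mulVec continuous_id).neg
    simpa [Function.comp_def] using (h.tendsto 0).comp hc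
  have hYlim : ∀ k, Tendsto (fun n => Y n k) atTop (𝓝 (y k)) := by
    intro k
    have := (tendsto_const_nhds (x := y k)).add
      ((hcont (S.U k₀ α Mp z k) (ha.comp tendsto_neg_atTop_atBot)).add
        (hcont (S.U k₀ α Mm z k) hb))
    rwa [add_zero, add_zero] at this
  have hElim : ∀ k, Tendsto (fun n => S.energy (Y n) k) atTop (𝓝 (S.energy y k)) := by
    intro k
    have h : Continuous fun x : Fin m ⊕ Fin m → ℂ => (star x ⬝ᵥ (S.A k *ᵥ x)).re :=
      Complex.continuous_re.comp
        (continuous_id.star.dotProduct (continuous_const.matrix_mulVec continuous_id))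
    exact (h.tendsto (y k)).comp (hYlim k)
  refine summable_subtype_of_sum_le (energy_nonneg hS y) (C := (∑' k, S.energy f k) / z.im ^ 2)
    fun u _ => ⟨u, subset_rfl, ?_⟩
  rw [le_div_iff₀' (by positivity)]
  refine le_of_tendsto ((tendsto_finsetSum u fun k _ => hElim k).const_mul (z.im ^ 2)) ?_
  obtain ⟨d, hd⟩ := u.finite_toSet.bddAbove
  obtain ⟨c, hc⟩ := u.finite_toSet.bddBelow
  filter_upwards [eventually_gt_atTop (max |k₀| (max d (-c)))] with n hn
  rw [max_lt_iff, max_lt_iff] at hn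
  refine le_trans ?_ (hYbound n hn.1)
  refine mul_le_mul_of_nonneg_left ?_ (sq_nonneg _)
  refine Finset.sum_le_sum_of_subset_of_nonneg (fun k hk => ?_) fun k _ _ => energy_nonneg hS _ k
  have h1 := hd (Finset.mem_coe.2 hk)
  have h2 := hc (Finset.mem_coe.2 hk)
  rw [Finset.mem_Ioc]
  omega

/-! ### Boundary behaviour and construction of the Green's solution -/

theorem BC_glue {S : HamSystem m} (hS : S.Hyp) {k₀ : ℤ}
    {α : Matrix (Fin m) (Fin m ⊕ Fin m) ℂ} (hα : IsBoundaryData α)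
    {Mp Mm : Matrix (Fin m) (Fin m) ℂ} (z : ℂ) {a b : ℤ → Fin m → ℂ}
    (ha : Tendsto a atBot (𝓝 0)) (hb : Tendsto b atTop (𝓝 0)) :
    S.BC k₀ α Mp z atTop (S.glue k₀ α Mp Mm z a b) ∧
      S.BC k₀ α Mm z atBot (S.glue k₀ α Mp Mm z a b) := by
  have hcont : ∀ (X : Matrix (Fin m) (Fin m) ℂ) {c : ℤ → Fin m → ℂ} {F : Filter ℤ},
      Tendsto c F (𝓝 0) → Tendsto (fun n => X *ᵥ ((Mm - Mp)⁻¹ *ᵥ c n)) F (𝓝 0) := by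
    intro X c F hc
    have h : Continuous fun x : Fin m → ℂ => X *ᵥ ((Mm - Mp)⁻¹ *ᵥ x) :=
      continuous_const.matrix_mulVec (continuous_const.matrix_mulVec continuous_id)
    simpa [Function.comp_def] using (h.tendsto 0).comp hc
  simp only [BC, hatMat_U_star_mulVec_hat hS k₀ hα Mp Mm _ z (hat_glue S k₀ α Mp Mm z a b _),
    sub_self, zero_mulVec, zero_add, add_zero]
  exact ⟨hcont _ hb, hcont _ ha⟩

theorem exists_greenSol_eq_glue {S : HamSystem m} (hS : S.Hyp) {k₀ : ℤ}
    {α : Matrix (Fin m) (Fin m ⊕ Fin m) ℂ} (hα : IsBoundaryData α)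
    {Mp Mm : Matrix (Fin m) (Fin m) ℂ} {z : ℂ} (hz : z.im ≠ 0) (hω : IsUnit (Mm - Mp))
    (hp : S.PlusIneq k₀ α Mp z) (hm : S.MinusIneq k₀ α Mm z)
    {f : ℤ → Fin m ⊕ Fin m → ℂ} (hf : S.MemL2 Set.univ f) :
    ∃ a b, S.greenSol k₀ α Mp Mm z f = S.glue k₀ α Mp Mm z a b ∧
      (∀ k, Summable fun l => S.green k₀ α Mp Mm z k l *ᵥ (S.A l *ᵥ f l)) ∧
      S.IsSolNonhom z f (S.glue k₀ α Mp Mm z a b) ∧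
      Tendsto a atBot (𝓝 0) ∧ Tendsto b atTop (𝓝 0) := by
  have hz' : (star z).im ≠ 0 := by
    rw [show (star z).im = -z.im from Complex.conj_im z]
    exact neg_ne_zero.2 hz
  set ga := fun l => (S.U k₀ α Mmᴴ (star z) l)ᴴ *ᵥ (S.A l *ᵥ f l) with hga
  set gb := fun l => (S.U k₀ α Mpᴴ (star z) l)ᴴ *ᵥ (S.A l *ᵥ f l) with hgb
  -- The Weyl solutions at `z̄` are square summable only up to, or from, `k₀`; moving the cut to `k`
  -- changes finitely many terms.
  have sa : ∀ k, Summable ((Set.Iic k).indicator ga) := fun k =>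
    summable_indicator_conjTranspose_mulVec hS ((hm.adjoint hS hα).memL2 hS hz') hf
      ((Set.finite_Ioc k₀ k).subset fun x hx => ⟨not_le.1 hx.2, hx.1⟩)
  have sb : ∀ k, Summable ((Set.Ioi k).indicator gb) := fun k =>
    summable_indicator_conjTranspose_mulVec hS ((hp.adjoint hS hα).memL2 hS hz') hf
      ((Set.finite_Ioo k k₀).subset fun x hx => ⟨hx.1, not_le.1 hx.2⟩)
  have hs := hasSum_green (S := S) (k₀ := k₀) (α := α) (Mp := Mp) (Mm := Mm) (z := z)
    (fun k => (sa k).hasSum) (fun k => (sb k).hasSum)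
  refine ⟨_, _, funext fun k => (hs k).tsum_eq, fun k => (hs k).summable, ?_, ?_, ?_⟩
  · exact isSolNonhom_glue hS k₀ hα hω z (fun k => tsum_indicator_Iic (sa _))
      (fun k => tsum_indicator_Ioi (sb _))
  · refine tendsto_tsum_indicator (sa k₀) ?_ fun l => ?_
    · filter_upwards [eventually_le_atBot k₀] with k hk using Set.Iic_subset_Iic.2 hk
    · filter_upwards [eventually_lt_atBot l] with k hk using not_le.2 hk
  · refine tendsto_tsum_indicator (sb k₀) ?_ fun l => ?_
    · filter_upwards [eventually_ge_atTop k₀] with k hk using Set.Ioi_subset_Ioi hk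
    · filter_upwards [eventually_ge_atTop l] with k hk using not_lt.2 hk

end HamSystem

/-! ### Assembly of the theorem -/

theorem mainTheorem2 {m : ℕ} (S : HamSystem m) (hS : S.Hyp) (k₀ : ℤ)
    (α : Matrix (Fin m) (Fin m ⊕ Fin m) ℂ) (hα : HamSystem.IsBoundaryData α)
    (z : ℂ) (hz : z.im ≠ 0)
    (hplus : HamSystem.IsLimitPoint (S.limDiskPlus k₀ α z) ∨
      HamSystem.IsLimitCircle (S.limDiskPlus k₀ α z))
    (hminus : HamSystem.IsLimitPoint (S.limDiskMinus k₀ α z) ∨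
      HamSystem.IsLimitCircle (S.limDiskMinus k₀ α z))
    (Mp Mm : Matrix (Fin m) (Fin m) ℂ)
    (hMp : Mp ∈ frontier (S.limDiskPlus k₀ α z))
    (hMm : Mm ∈ frontier (S.limDiskMinus k₀ α z))
    (f : ℤ → Fin m ⊕ Fin m → ℂ) (hf : S.MemL2 Set.univ f) :
    -- the series defining `y` converges, and `y` is an `ℓ²_A(ℤ)`-solution with both conditions
    (∀ k, Summable fun ℓ : ℤ => S.green k₀ α Mp Mm z k ℓ *ᵥ (S.A ℓ *ᵥ f ℓ)) ∧
    S.MemL2 Set.univ (S.greenSol k₀ α Mp Mm z f) ∧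
    S.IsSolNonhom z f (S.greenSol k₀ α Mp Mm z f) ∧
    S.BC k₀ α Mp z atTop (S.greenSol k₀ α Mp Mm z f) ∧
    S.BC k₀ α Mm z atBot (S.greenSol k₀ α Mp Mm z f) ∧
    -- uniqueness
    (∀ u, S.MemL2 Set.univ u → S.IsSolNonhom z f u → S.BC k₀ α Mp z atTop u →
      S.BC k₀ α Mm z atBot u → u = S.greenSol k₀ α Mp Mm z f) ∧
    -- limit point case at `+∞`: the condition there is automatic and can be dropped
    (HamSystem.IsLimitPoint (S.limDiskPlus k₀ α z) →
      Set.finrank ℂ (S.solSpace z (Set.Ici k₀)) = m →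
      (∀ u, S.MemL2 Set.univ u → S.IsSolNonhom z f u → S.BC k₀ α Mp z atTop u) ∧
      (∀ u, S.MemL2 Set.univ u → S.IsSolNonhom z f u → S.BC k₀ α Mm z atBot u →
        u = S.greenSol k₀ α Mp Mm z f)) ∧
    -- limit point case at `-∞`: the condition there is automatic and can be dropped
    (HamSystem.IsLimitPoint (S.limDiskMinus k₀ α z) →
      Set.finrank ℂ (S.solSpace z (Set.Iic k₀)) = m →
      (∀ u, S.MemL2 Set.univ u → S.IsSolNonhom z f u → S.BC k₀ α Mm z atBot u) ∧
      (∀ u, S.MemL2 Set.univ u → S.IsSolNonhom z f u → S.BC k₀ α Mp z atTop u →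
        u = S.greenSol k₀ α Mp Mm z f)) ∧
    -- limit point case at both endpoints: both conditions can be dropped
    (HamSystem.IsLimitPoint (S.limDiskPlus k₀ α z) →
      Set.finrank ℂ (S.solSpace z (Set.Ici k₀)) = m →
      HamSystem.IsLimitPoint (S.limDiskMinus k₀ α z) →
      Set.finrank ℂ (S.solSpace z (Set.Iic k₀)) = m →
      ∀ u, S.MemL2 Set.univ u → S.IsSolNonhom z f u → u = S.greenSol k₀ α Mp Mm z f) := by
  have hp := HamSystem.plusIneq_of_mem_frontier hS hz hMp
  have hm := HamSystem.minusIneq_of_mem_frontier hS hz hMm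
  have hω := HamSystem.isUnit_sub_of_plusIneq_of_minusIneq hS hα hz hp hm
  obtain ⟨a, b, hy, hsum, hsol, ha, hb⟩ :=
    HamSystem.exists_greenSol_eq_glue hS hα hz hω hp hm hf
  obtain ⟨hBp, hBm⟩ := HamSystem.BC_glue hS (k₀ := k₀) hα (Mp := Mp) (Mm := Mm) z ha hb
  have hL2 := HamSystem.memL2_glue hS hz hp hm hf hsol ha hb
  rw [← hy] at hsol hBp hBm hL2
  have huniq : ∀ u, S.IsSolNonhom z f u → S.BC k₀ α Mp z atTop u → S.BC k₀ α Mm z atBot u →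
      u = S.greenSol k₀ α Mp Mm z f := fun u hu hup hum =>
    sub_eq_zero.1 ((hu.sub hsol).eq_zero_of_BC hS k₀ hα hω (hup.sub hBp) (hum.sub hBm))
  -- Any two square summable solutions of (N) differ by some `U v`, which satisfies the boundary
  -- condition identically, so the condition is inherited from the Green's solution.
  have hauto : ∀ {I : Set ℤ} {M : Matrix (Fin m) (Fin m) ℂ} {F : Filter ℤ},
      Set.finrank ℂ (S.solSpace z I) = m → (∀ v, S.MemL2 I fun k => S.U k₀ α M z k *ᵥ v) →
      S.BC k₀ α M z F (S.greenSol k₀ α Mp Mm z f) →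
      ∀ u, S.MemL2 Set.univ u → S.IsSolNonhom z f u → S.BC k₀ α M z F u := by
    intro I M F hdim hM hB u hu hus
    obtain ⟨v, hv⟩ := HamSystem.exists_eq_U_mulVec_of_finrank hS k₀ hα hω hdim hM (hus.sub hsol)
      ((hu.sub hS hL2).of_univ I)
    rw [← add_sub_cancel (S.greenSol k₀ α Mp Mm z f) u, hv]
    exact hB.add (HamSystem.BC_U_mulVec hS k₀ hα M z F v)
  refine ⟨hsum, hL2, hsol, hBp, hBm, fun u _ hu hup hum => huniq u hu hup hum, ?_, ?_, ?_⟩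
  · intro _ hd
    have h := hauto (F := atTop) hd (hp.memL2 hS hz) hBp
    exact ⟨h, fun u hu hus hum => huniq u hus (h u hu hus) hum⟩
  · intro _ hd
    have h := hauto (F := atBot) hd (hm.memL2 hS hz) hBm
    exact ⟨h, fun u hu hus hup => huniq u hus hup (h u hu hus)⟩
  · intro _ hd _ hd' u hu hus
    exact huniq u hus (hauto hd (hp.memL2 hS hz) hBp u hu hus)
      (hauto hd' (hm.memL2 hS hz) hBm u hu hus)
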